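/- Let $\mathcal A=\{H_1,\dots,H_n\}$ ($n\ge 0$) be a finite set of distinct affine lines in $\mathbb R^2$, $H_i=\{\alpha_i=0\}$ with $\alpha_i(x)=a_ix_1+b_ix_2+c_i$ real and $(a_i,b_i)\ne(0,0)$. Let $M(\mathcal A)=\{z\in\mathbb C^2\mid \alpha_i(z)\neq0 \text{ for all } i\}$, and let $\mathrm{ch}(\mathcal A)$ be the set of chambers, i.e. of connected components of $\mathbb R^2\setminus\bigcup_iH_i$, regarded as subsets of $M(\mathcal A)$ via $\mathbb R^2\subset\mathbb C^2$. Let $\mathcal F^0\subset\mathcal F^1\subset\mathcal F^2=\mathbb R^2$ be a flag consisting of a point $\mathcal F^0=\{o\}$ and a line $\mathcal F^1=o+\mathbb Rv$, $v\ne0$, such that * each $H_i$ meets $\mathcal F^1$ in exactly one point $o+t_iv$, and $0<t_n<\dots<t_1$; * $\alpha_i(o)<0$ for all $i$; * all intersection points of lines of $\mathcal A$ lie strictly on one and the same side of $\mathcal F^1$. Put $\mathrm{ch}_2^{\mathcal F}(\mathcal A)=\{C\in\mathrm{ch}(\mathcal A)\mid C\cap\mathcal F^1=\emptyset\}$. Put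 $\alpha_0=-1$, and for $i=1,\dots,n$ let $$S_i=\Big\{z\in M(\mathcal A)\ \Big|\ \alpha_{i-1}(z)\alpha_i(z)\ne0,\ \frac{\alpha_{i-1}(z)}{\alpha_i(z)}\in\mathbb R_{<0}\Big\},\qquad S_i^\circ=S_i\setminus\bigcup_{C\in\mathrm{ch}_2^{\mathcal F}(\mathcal A)}C,\qquad U=M(\mathcal A)\setminus\bigcup_{i=1}^nS_i .$$ **Theorem.** Each $S_i$ is a closed smooth $3$-dimensional submanifold of $M(\mathcal A)$, and: (i) For $i\ne j$, $S_i$ and $S_j$ intersect transversely, and $S_i\cap S_j=\bigsqcup C$, the disjoint union over all chambers $C$ with $\alpha_i(C)\alpha_{i-1}(C)<0$ and $\alpha_j(C)\alpha_{j-1}(C)<0$. (ii) Each $S_i^\circ$ is a contractible smooth $3$-dimensional submanifold of $\mathbb C^2$. (iii) $U$ is a contractible $4$-manifold (an open subset of $\mathbb C^2$). Moreover, the chambers $C\in\mathrm{ch}_2^{\mathcal F}(\mathcal A)$ are contractible smooth $2$-dimensional submanifolds of $\mathbb C^2$, and $$M(\mathcal A)=U\ \sqcup\ \bigsqcup_{i=1}^nS_i^\circ\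 \sqcup\bigsqcup_{C\in\mathrm{ch}_2^{\mathcal F}(\mathcal A)}C$$ is a partition of $M(\mathcal A)$ into $1$ piece of codimension $0$, $n$ pieces of codimension $1$ and $\sum_p(m_p-1)$ pieces of codimension $2$, where $p$ runs over the finitely many points lying on at least two lines of $\mathcal A$ and $m_p$ is the number of lines through $p$. (The partition is minimal in the sense that $1$, $n$, $\sum_p(m_p-1)$ are the coefficients of the Poincaré polynomial of $\mathcal A$.) -/

import Mathlib

open Set Topology
open scoped ContDiff

noncomputable section

/-- A real affine form `a x₁ + b x₂ + c` in two variables; constants are allowed. -/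
structure AffineForm where
  a : ℝ
  b : ℝ
  c : ℝ

namespace AffineForm

/-- The value at a point of `ℝ²`. -/
def eval (f : AffineForm) (x : ℝ × ℝ) : ℝ := f.a * x.1 + f.b * x.2 + f.c

/-- The value at a point of `ℂ²`. -/
def evalC (f : AffineForm) (z : ℂ × ℂ) : ℂ := f.a * z.1 + f.b * z.2 + f.c

/-- The sail bound to `f` and `g`: the points of `ℂ²` where `f g ≠ 0` and `f / g` is a negative
real number. -/
def sail (f g : AffineForm) : Set (ℂ × ℂ) :=
  {z | f.evalC z * g.evalC z ≠ 0 ∧ ∃ r : ℝ, r < 0 ∧ f.evalC z / g.evalC z = (r : ℂ)}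

end AffineForm

/-- The inclusion of `ℝ²` in `ℂ²`. -/
def realPoint (x : ℝ × ℝ) : ℂ × ℂ := ((x.1 : ℂ), (x.2 : ℂ))

/-- The determinant of two vectors of the plane. -/
def planeDet (u v : ℝ × ℝ) : ℝ := u.1 * v.2 - u.2 * v.1

/-- `n` distinct affine lines in `ℝ²` with chosen equations. The index `i : Fin n` stands for the
line number `i + 1`. -/
structure LineArrangement (n : ℕ) where
  form : Fin n → AffineForm
  nondeg : ∀ i, ((form i).a, (form i).b) ≠ ((0, 0) : ℝ × ℝ)
  distinct : Function.Injective fun i => {x : ℝ × ℝ | (form i).eval x = 0}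

namespace LineArrangement

variable {n : ℕ}

/-- The forms `α₀ = -1, α₁, …, αₙ`. -/
def alpha (A : LineArrangement n) : Fin (n + 1) → AffineForm := Fin.cons ⟨0, 0, -1⟩ A.form

/-- The points of `ℝ²` that lie on at least two of the lines. -/
def intersections (A : LineArrangement n) : Set (ℝ × ℝ) :=
  {p | ∃ i j, i ≠ j ∧ (A.form i).eval p = 0 ∧ (A.form j).eval p = 0}

/-- The number of lines through `p`. -/
def mult (A : LineArrangement n) (p : ℝ × ℝ) : ℕ := {i | (A.form i).eval p = 0}.ncard

/-- The complement of the lines in `ℝ²`. -/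
def realComplement (A : LineArrangement n) : Set (ℝ × ℝ) := {x | ∀ i, (A.form i).eval x ≠ 0}

/-- The complement `M(A)` of the complexified lines in `ℂ²`. -/
def complement (A : LineArrangement n) : Set (ℂ × ℂ) := {z | ∀ i, (A.form i).evalC z ≠ 0}

/-- The chambers: the connected components of the complement of the lines in `ℝ²`. -/
def chambers (A : LineArrangement n) : Set (Set (ℝ × ℝ)) :=
  {C | ∃ x ∈ A.realComplement, C = connectedComponentIn A.realComplement x}

/-- `Sᵢ = S(αᵢ₋₁, αᵢ) ∩ M(A)`, for the line number `i + 1` in the indexing by `Fin n`. -/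
def sail (A : LineArrangement n) (i : Fin n) : Set (ℂ × ℂ) :=
  AffineForm.sail (A.alpha i.castSucc) (A.alpha i.succ) ∩ A.complement

/-- `αᵢ(C) αᵢ₋₁(C) < 0`. -/
def SignChange (A : LineArrangement n) (i : Fin n) (C : Set (ℝ × ℝ)) : Prop :=
  ∀ x ∈ C, (A.alpha i.succ).eval x * (A.alpha i.castSucc).eval x < 0

/-- The complement of the sails in `M(A)`. -/
def openPiece (A : LineArrangement n) : Set (ℂ × ℂ) := A.complement \ ⋃ i, A.sail i

/-- A generic flag `{base} ⊂ base + ℝ dir ⊂ ℝ²` for which the lines are numbered, and the signs of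
their equations chosen, as follows. Each line meets `base + ℝ dir` in the single point
`base + pos i • dir`, where `0 < pos (n-1) < ⋯ < pos 0` (so `base` does not separate these points),
the forms are negative at `base`, and all intersection points of the lines lie strictly on one and
the same side of `base + ℝ dir`. -/
structure NumberedFlag (A : LineArrangement n) where
  base : ℝ × ℝ
  dir : ℝ × ℝ
  dir_ne_zero : dir ≠ 0
  pos : Fin n → ℝ
  eval_eq_zero_iff : ∀ i t, (A.form i).eval (base + t • dir) = 0 ↔ t = pos i
  pos_pos : ∀ i, 0 < pos i
  pos_strictAnti : StrictAnti pos
  eval_base_neg : ∀ i, (A.form i).eval base < 0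
  same_side : ∀ p ∈ A.intersections, ∀ q ∈ A.intersections,
    0 < planeDet dir (p - base) * planeDet dir (q - base)

namespace NumberedFlag

variable {A : LineArrangement n}

/-- The members `∅ = F⁻¹ ⊂ F⁰ ⊂ F¹ ⊂ F² = ℝ²` of the flag. -/
def space (F : A.NumberedFlag) (k : ℤ) : Set (ℝ × ℝ) :=
  if k < 0 then ∅
  else if k = 0 then {F.base}
  else if k = 1 then range fun t : ℝ => F.base + t • F.dir
  else univ

/-- The chambers that meet `Fᵏ` but not `Fᵏ⁻¹`. -/
def ch (F : A.NumberedFlag) (k : ℤ) : Set (Set (ℝ × ℝ)) :=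
  {C | C ∈ A.chambers ∧ (C ∩ F.space k).Nonempty ∧ C ∩ F.space (k - 1) = ∅}

/-- `Sᵢ° = Sᵢ` minus the chambers that meet neither `F⁰` nor `F¹`. -/
def sailPiece (F : A.NumberedFlag) (i : Fin n) : Set (ℂ × ℂ) :=
  A.sail i \ ⋃ C ∈ F.ch 2, realPoint '' C

/-- All the pieces: the complement of the sails, the pieces `Sᵢ°`, and the chambers that meet
neither `F⁰` nor `F¹`. -/
def piece (F : A.NumberedFlag) : Unit ⊕ Fin n ⊕ F.ch 2 → Set (ℂ × ℂ)
  | Sum.inl _ => A.openPiece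
  | Sum.inr (Sum.inl i) => F.sailPiece i
  | Sum.inr (Sum.inr C) => realPoint '' (C : Set (ℝ × ℝ))

end NumberedFlag

end LineArrangement

section Submanifolds

variable {E : Type*} [NormedAddCommGroup E] [NormedSpace ℝ E]

/-- `S` is an embedded smooth submanifold of dimension `d` of the finite-dimensional real vector
space `E`: near each of its points it is the zero set of a smooth map to `ℝᶜ`, `c + d = dim E`,
whose derivative is surjective along `S`. -/
def IsSmoothSubmanifold (d : ℕ) (S : Set E) : Prop :=
  ∃ c : ℕ, c + d = Module.finrank ℝ E ∧
    ∀ x ∈ S, ∃ W : Set E, IsOpen W ∧ x ∈ W ∧ ∃ f : E → (Fin c → ℝ),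
      ContDiffOn ℝ ∞ f W ∧ (∀ y ∈ S ∩ W, Function.Surjective (fderiv ℝ f y)) ∧
      S ∩ W = {y ∈ W | f y = 0}

/-- The velocities at `x` of the smooth curves in `S` through `x`. For a smooth submanifold `S`,
this is its tangent space at `x`. -/
def tangentVectors (S : Set E) (x : E) : Set E :=
  {v | ∃ ε : ℝ, 0 < ε ∧ ∃ c : ℝ → E, ContDiffOn ℝ ∞ c (Ioo (-ε) ε) ∧
    (∀ t ∈ Ioo (-ε) ε, c t ∈ S) ∧ c 0 = x ∧ HasDerivAt c v 0}

/-- At each common point, the two tangent spaces span the ambient space. -/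
def MeetTransversely (S T : Set E) : Prop :=
  ∀ x ∈ S ∩ T, ∀ w : E, ∃ u ∈ tangentVectors S x, ∃ v ∈ tangentVectors T x, u + v = w

end Submanifolds

end

/-!
Let `o` be the base point and `v` the direction of the flag. In the coordinates `(x, y)` of `ℂ²` for
which `(x, y)` stands for `o + x v + y e`, with `e` orthogonal to `v`, the forms are positive
multiples of `x - tᵢ - sᵢ y`, where `t₁ > t₂ > ⋯ > tₙ` are the positions of the lines on the flag
(`NumberedFlag.evalC_coord`). So a sail consists of the zeros of `αᵢ₋₁ + ρ αᵢ`, for `ρ > 0`, in the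
complement of the lines.

The main tool is the shear `p + √-1 q ↦ (p + r q) + √-1 q`. It acts on the values of all real affine
forms by one real linear automorphism of `ℂ`, hence preserves all sails. If `Im y ≠ 0`, some shear
moves the point to `Re y = 0`, where `αᵢ₋₁ + ρ αᵢ = 0` forces the real part of `x` to lie strictly
between `tᵢ` and `tᵢ₋₁`, where `t₀ = ∞` (`Sweep.foot_signs`). So different sails meet in real points
only, and sails meet no complexified line outside `Im y = 0`. All statements on intersections,
transversality and the partition follow from this and from the signs of the forms at real points.

Contractibility is shown by straight-line homotopies onto the slice `Re y = 0`. On `Sᵢ°` the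
homotopy keeps the quotient `αᵢ₋₁ / αᵢ` and `Im y`, and ends in a copy of `(0, ∞) × ℝ`
(`Sweep.contractibleSpace_sailPiece`). On the complement of the sails
(`Sweep.contractibleSpace_openPiece`) it moves the real part along the shear near those points that
would run into a sail otherwise, and elsewhere in a direction in which all forms decrease; a Urysohn
function interpolates. In the slice, the removed set at height `Im y = w` is the graph of `w G` over
`[tₙ, ∞)`, where `G` interpolates the values `sᵢ` at `tᵢ` (`Sweep.exists_slice`); subtracting the
graph gives a slit plane times a line.

The number of chambers that miss the flag is the number of all chambers minus `n + 1`. The former is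
found by adding the lines one at a time: a new line splits exactly the cells it meets, and it meets
one more than there are intersection points on it (`ncard_signPatterns_insert`,
`ncard_signPatterns_line`).
-/

noncomputable section

/-! ### Counting the cells of an arrangement by their sign patterns -/

section SignPatterns

variable {ι V : Type*} [AddCommGroup V] [Module ℝ V]

open scoped Classical in
/-- The indices in `s` of the functions that are positive at `x`. -/
def signPattern (f : ι → V →ᵃ[ℝ] ℝ) (s : Finset ι) (x : V) : Finset ι :=
  s.filter fun i => 0 < f i x

/-- The sign patterns at those points of `K` where no function with index in `s` vanishes. -/
def signPatterns (f : ι → V →ᵃ[ℝ] ℝ) (s : Finset ι) (K : Set V) : Set (Finset ι) :=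
  signPattern f s '' {x | x ∈ K ∧ ∀ i ∈ s, f i x ≠ 0}

variable {f : ι → V →ᵃ[ℝ] ℝ} {s : Finset ι} {a : ι}

lemma mem_signPattern {x : V} {i : ι} : i ∈ signPattern f s x ↔ i ∈ s ∧ 0 < f i x := by
  simp [signPattern]

lemma signPattern_subset (x : V) : signPattern f s x ⊆ s := Finset.filter_subset _ _

lemma finite_signPatterns (K : Set V) : (signPatterns f s K).Finite := by
  refine (s.powerset.finite_toSet).subset ?_
  rintro _ ⟨x, -, rfl⟩
  simpa using signPattern_subset x

lemma signPattern_eq_iff {x y : V} (hx : ∀ i ∈ s, f i x ≠ 0) (hy : ∀ i ∈ s, f i y ≠ 0) :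
    signPattern f s x = signPattern f s y ↔ ∀ i ∈ s, 0 < f i x * f i y := by
  rw [Finset.ext_iff]
  simp only [mem_signPattern]
  refine forall_congr' fun i => ?_
  by_cases hi : i ∈ s
  · rcases lt_or_gt_of_ne (hx i hi) with h1 | h1 <;> rcases lt_or_gt_of_ne (hy i hi) with h2 | h2
    · simp [hi, h1.not_gt, h2.not_gt, mul_pos_of_neg_of_neg h1 h2]
    · simp [hi, h1.not_gt, h2, (mul_neg_of_neg_of_pos h1 h2).not_gt]
    · simp [hi, h1, h2.not_gt, (mul_neg_of_pos_of_neg h1 h2).not_gt]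
    · simp [hi, h1, h2, mul_pos h1 h2]
  · simp [hi]

lemma signPattern_insert_of_pos [DecidableEq ι] {x : V} (h : 0 < f a x) :
    signPattern f (insert a s) x = insert a (signPattern f s x) := by
  simp [signPattern, Finset.filter_insert, h]

lemma signPattern_insert_of_not_pos [DecidableEq ι] {x : V} (h : ¬ 0 < f a x) :
    signPattern f (insert a s) x = signPattern f s x := by
  simp [signPattern, Finset.filter_insert, h]

lemma AffineMap.lineMap_real_apply (g : V →ᵃ[ℝ] ℝ) (x y : V) (c : ℝ) :
    g (AffineMap.lineMap x y c) = (1 - c) * g x + c * g y := by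
  rw [AffineMap.apply_lineMap, AffineMap.lineMap_apply_module]
  simp

/-- Moving a little along a line does not change the sign pattern at a point where no function
vanishes. -/
lemma eventually_signPattern_lineMap {x : V} (hx : ∀ i ∈ s, f i x ≠ 0) (y : V) :
    ∀ᶠ ε in 𝓝 (0 : ℝ), (∀ i ∈ s, f i (AffineMap.lineMap x y ε) ≠ 0) ∧
      signPattern f s (AffineMap.lineMap x y ε) = signPattern f s x := by
  have h : ∀ᶠ ε in 𝓝 (0 : ℝ), ∀ i ∈ s, 0 < f i (AffineMap.lineMap x y ε) * f i x := by
    rw [Filter.eventually_all_finset]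
    intro i hi
    have hc : Continuous fun ε : ℝ => f i (AffineMap.lineMap x y ε) * f i x := by
      simp only [AffineMap.lineMap_real_apply]
      fun_prop
    refine hc.continuousAt.eventually (lt_mem_nhds ?_)
    simpa using (mul_self_pos.2 (hx i hi))
  filter_upwards [h] with ε hε
  have h0 : ∀ i ∈ s, f i (AffineMap.lineMap x y ε) ≠ 0 := fun i hi h0 => by
    have := hε i hi
    simp [h0] at this
  exact ⟨h0, (signPattern_eq_iff h0 hx).2 hε⟩

/-- Deletion and restriction: adding a function to the family splits in two exactly those cells
that meet its zero set. -/
lemma ncard_signPatterns_insert [DecidableEq ι] (ha : a ∉ s) (hne : ∃ x, f a x ≠ 0) :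
    (signPatterns f (insert a s) univ).ncard =
      (signPatterns f s univ).ncard + (signPatterns f s {x | f a x = 0}).ncard := by
  set P := signPatterns f s {x | 0 < f a x} with hP
  set N := signPatterns f s {x | f a x < 0} with hN
  have hnot : ∀ x : V, a ∉ signPattern f s x := fun x h => ha (signPattern_subset x h)
  have hsplit : signPatterns f (insert a s) univ = insert a '' P ∪ N := by
    ext T
    constructor
    · rintro ⟨x, ⟨-, hx⟩, rfl⟩
      have hxs : ∀ i ∈ s, f i x ≠ 0 := fun i hi => hx i (Finset.mem_insert_of_mem hi)
      rcases lt_or_gt_of_ne (hx a (Finset.mem_insert_self a s)) with h | h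
      · right
        rw [signPattern_insert_of_not_pos h.not_gt]
        exact ⟨x, ⟨h, hxs⟩, rfl⟩
      · left
        rw [signPattern_insert_of_pos h]
        exact ⟨_, ⟨x, ⟨h, hxs⟩, rfl⟩, rfl⟩
    · rintro (⟨_, ⟨x, ⟨h, hx⟩, rfl⟩, rfl⟩ | ⟨x, ⟨h, hx⟩, rfl⟩)
      · refine ⟨x, ⟨mem_univ _, ?_⟩, signPattern_insert_of_pos h⟩
        intro i hi
        rcases Finset.mem_insert.1 hi with rfl | hi
        exacts [h.ne', hx i hi]
      · refine ⟨x, ⟨mem_univ _, ?_⟩, signPattern_insert_of_not_pos (not_lt.2 h.le)⟩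
        intro i hi
        rcases Finset.mem_insert.1 hi with rfl | hi
        exacts [h.ne, hx i hi]
  have hdisj : Disjoint (insert a '' P) N := by
    rw [Set.disjoint_left]
    rintro _ ⟨T, -, rfl⟩ ⟨x, -, hx⟩
    exact hnot x (hx ▸ Finset.mem_insert_self a T)
  have hinj : InjOn (insert a : Finset ι → Finset ι) P := by
    rintro _ ⟨x, -, rfl⟩ _ ⟨y, -, rfl⟩ h
    have := congrArg (Finset.erase · a) h
    simpa [Finset.erase_insert (hnot x), Finset.erase_insert (hnot y)] using this
  have hPf : P.Finite := finite_signPatterns _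
  have hNf : N.Finite := finite_signPatterns _
  have hunion : P ∪ N = signPatterns f s univ := by
    ext T
    constructor
    · rintro (⟨x, ⟨-, hx⟩, rfl⟩ | ⟨x, ⟨-, hx⟩, rfl⟩) <;> exact ⟨x, ⟨mem_univ _, hx⟩, rfl⟩
    · rintro ⟨x, ⟨-, hx⟩, rfl⟩
      rcases lt_trichotomy (f a x) 0 with h | h | h
      · exact Or.inr ⟨x, ⟨h, hx⟩, rfl⟩
      · obtain ⟨y, hy⟩ := hne
        obtain ⟨ε, hε, hε0⟩ := ((eventually_signPattern_lineMap hx y).filter_mono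
          nhdsWithin_le_nhds |>.and (self_mem_nhdsWithin (s := Ioi (0 : ℝ)))).exists
        have hval : f a (AffineMap.lineMap x y ε) = ε * f a y := by
          rw [AffineMap.lineMap_real_apply, h]; ring
        rcases lt_or_gt_of_ne hy with h' | h'
        · exact Or.inr ⟨_, ⟨by simpa [hval] using mul_neg_of_pos_of_neg hε0 h', hε.1⟩, hε.2⟩
        · exact Or.inl ⟨_, ⟨by simpa [hval] using mul_pos hε0 h', hε.1⟩, hε.2⟩
      · exact Or.inl ⟨x, ⟨h, hx⟩, rfl⟩
  have hinter : P ∩ N = signPatterns f s {x | f a x = 0} := by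
    ext T
    constructor
    · rintro ⟨⟨x, ⟨hx0, hx⟩, rfl⟩, ⟨y, ⟨hy0, hy⟩, hxy⟩⟩
      have hxy' := (signPattern_eq_iff hy hx).1 hxy
      simp only [mem_ofPred_eq] at hx0 hy0
      -- the point of the segment where `f a` vanishes
      set c := f a x / (f a x - f a y) with hc
      have hd : 0 < f a x - f a y := by linarith
      have hc0 : 0 < c := div_pos hx0 hd
      have hc1 : c < 1 := by rw [hc, div_lt_one hd]; linarith
      have hsign : ∀ i ∈ s, 0 < f i (AffineMap.lineMap x y c) * f i x := by
        intro i hi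
        have h1 := hxy' i hi
        have h2 := mul_self_pos.2 (hx i hi)
        rw [AffineMap.lineMap_real_apply]
        nlinarith [mul_pos hc0 h1, mul_pos (sub_pos.2 hc1) h2]
      have hne0 : ∀ i ∈ s, f i (AffineMap.lineMap x y c) ≠ 0 := fun i hi h0 => by
        have := hsign i hi
        simp [h0] at this
      refine ⟨AffineMap.lineMap x y c, ⟨?_, hne0⟩, (signPattern_eq_iff hne0 hx).2 hsign⟩
      simp only [mem_ofPred_eq, AffineMap.lineMap_real_apply]
      rw [hc]; field_simp; ring
    · rintro ⟨x, ⟨h, hx⟩, rfl⟩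
      simp only [mem_ofPred_eq] at h
      obtain ⟨y, hy⟩ := hne
      have hev := eventually_signPattern_lineMap hx y
      have hev' : ∀ᶠ ε in 𝓝 (0 : ℝ), (∀ i ∈ s, f i (AffineMap.lineMap x y (-ε)) ≠ 0) ∧
          signPattern f s (AffineMap.lineMap x y (-ε)) = signPattern f s x :=
        (continuous_neg.tendsto' (0 : ℝ) 0 neg_zero).eventually hev
      obtain ⟨ε, ⟨hε, hε'⟩, hε0⟩ := ((hev.and hev').filter_mono
        nhdsWithin_le_nhds |>.and (self_mem_nhdsWithin (s := Ioi (0 : ℝ)))).exists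
      have hε0 : 0 < ε := hε0
      have hval : ∀ c, f a (AffineMap.lineMap x y c) = c * f a y := by
        intro c
        rw [AffineMap.lineMap_real_apply, h]; ring
      rcases lt_or_gt_of_ne hy with h' | h'
      · refine ⟨⟨_, ⟨?_, hε'.1⟩, hε'.2⟩, ⟨_, ⟨?_, hε.1⟩, hε.2⟩⟩ <;>
          simp only [mem_ofPred_eq, hval] <;> nlinarith
      · refine ⟨⟨_, ⟨?_, hε.1⟩, hε.2⟩, ⟨_, ⟨?_, hε'.1⟩, hε'.2⟩⟩ <;>
          simp only [mem_ofPred_eq, hval] <;> nlinarith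
  rw [hsplit, Set.ncard_union_eq hdisj (hPf.image _) hNf, hinj.ncard_image,
    ← Set.ncard_union_add_ncard_inter P N hPf hNf, hunion, hinter]

lemma signPatterns_empty [Nonempty V] : signPatterns f ∅ univ = {∅} := by
  ext T
  simp [signPatterns, signPattern, eq_comm]

lemma signPatterns_comp {V' : Type*} [AddCommGroup V'] [Module ℝ V'] (γ : V' →ᵃ[ℝ] V) :
    signPatterns (fun i => (f i).comp γ) s univ = signPatterns f s (range γ) := by
  ext T
  constructor
  · rintro ⟨x, ⟨-, hx⟩, rfl⟩
    exact ⟨γ x, ⟨⟨x, rfl⟩, hx⟩, rfl⟩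
  · rintro ⟨_, ⟨⟨x, rfl⟩, hx⟩, rfl⟩
    exact ⟨x, ⟨mem_univ _, hx⟩, rfl⟩

end SignPatterns

section Counting

variable {ι : Type*}

lemma subsingleton_zeros_of_ne_zero {g : ℝ →ᵃ[ℝ] ℝ} (hg : ∃ x, g x ≠ 0) :
    {x | g x = 0}.Subsingleton := by
  intro x hx y hy
  by_contra hxy
  obtain ⟨w, hw⟩ := hg
  apply hw
  have : w = AffineMap.lineMap x y ((w - x) / (y - x)) := by
    have : y - x ≠ 0 := sub_ne_zero.2 (Ne.symm hxy)
    rw [AffineMap.lineMap_apply_module]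
    simp only [smul_eq_mul]
    field_simp
    ring
  rw [this, AffineMap.lineMap_real_apply, hx, hy]
  simp

lemma finite_zeros {f : ι → ℝ →ᵃ[ℝ] ℝ} {s : Finset ι} (hs : ∀ i ∈ s, ∃ x, f i x ≠ 0) :
    {x | ∃ i ∈ s, f i x = 0}.Finite := by
  have : {x | ∃ i ∈ s, f i x = 0} = ⋃ i ∈ s, {x | f i x = 0} := by ext; simp
  rw [this]
  exact s.finite_toSet.biUnion fun i hi => (subsingleton_zeros_of_ne_zero (hs i hi)).finite

/-- Finitely many points cut the real line into one more interval than there are points. -/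
lemma ncard_signPatterns_line [DecidableEq ι] {f : ι → ℝ →ᵃ[ℝ] ℝ} (s : Finset ι)
    (hs : ∀ i ∈ s, ∃ x, f i x ≠ 0) :
    (signPatterns f s univ).ncard = {x | ∃ i ∈ s, f i x = 0}.ncard + 1 := by
  induction s using Finset.induction_on with
  | empty => simp [signPatterns_empty]
  | insert a s ha ih =>
    have hs' : ∀ i ∈ s, ∃ x, f i x ≠ 0 := fun i hi => hs i (Finset.mem_insert_of_mem hi)
    have hane := hs a (Finset.mem_insert_self a s)
    rw [ncard_signPatterns_insert ha hane, ih hs']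
    have hfin := finite_zeros hs'
    by_cases h : ∃ x, f a x = 0 ∧ ∀ i ∈ s, f i x ≠ 0
    · obtain ⟨x, hx, hxs⟩ := h
      have hone : ∀ y, f a y = 0 ↔ y = x := fun y =>
        ⟨fun hy => subsingleton_zeros_of_ne_zero hane hy hx, fun hy => hy ▸ hx⟩
      have h1 : {y | ∃ i ∈ insert a s, f i y = 0} = insert x {y | ∃ i ∈ s, f i y = 0} := by
        ext y; simp [hone]
      have h2 : signPatterns f s {y | f a y = 0} = {signPattern f s x} := by
        ext T
        simp only [signPatterns, mem_ofPred_eq, hone, mem_image, mem_singleton_iff]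
        constructor
        · rintro ⟨y, ⟨rfl, -⟩, rfl⟩; rfl
        · rintro rfl; exact ⟨x, ⟨rfl, hxs⟩, rfl⟩
      rw [h1, h2, Set.ncard_insert_of_notMem (by simpa using hxs) hfin, Set.ncard_singleton]
    · push Not at h
      have h1 : {y | ∃ i ∈ insert a s, f i y = 0} = {y | ∃ i ∈ s, f i y = 0} := by
        ext y
        simp only [Finset.mem_insert, exists_eq_or_imp, mem_ofPred_eq, or_iff_right_iff_imp]
        exact h y
      have h2 : signPatterns f s {y | f a y = 0} = ∅ := by
        rw [Set.eq_empty_iff_forall_notMem]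
        rintro _ ⟨x, ⟨hx, hxs⟩, -⟩
        obtain ⟨i, hi, h0⟩ := h x hx
        exact hxs i hi h0
      rw [h1, h2, Set.ncard_empty]

open scoped Classical in
/-- The number of cells of an arrangement of distinct lines, each given with an affine
parametrization. -/
lemma ncard_signPatterns_lines [DecidableEq ι] {V : Type*} [AddCommGroup V] [Module ℝ V]
    {f : ι → V →ᵃ[ℝ] ℝ} (s : Finset ι) (hne : ∀ i ∈ s, ∃ x, f i x ≠ 0) (γ : ι → ℝ →ᵃ[ℝ] V)
    (hinj : ∀ i ∈ s, Function.Injective (γ i)) (hγ : ∀ i ∈ s, range (γ i) = {x | f i x = 0})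
    (hd : ∀ i ∈ s, ∀ j ∈ s, i ≠ j → ∃ x, f i x = 0 ∧ f j x ≠ 0) :
    (Function.support fun p => (s.filter fun i => f i p = 0).card - 1).Finite ∧
    (signPatterns f s univ).ncard =
      1 + s.card + ∑ᶠ p, ((s.filter fun i => f i p = 0).card - 1) := by
  induction s using Finset.induction_on with
  | empty => simp [signPatterns_empty, Function.support]
  | insert a s ha ih =>
    have hmem := fun i (hi : i ∈ s) => Finset.mem_insert_of_mem (a := i) (b := a) hi
    obtain ⟨ihf, ih⟩ := ih (fun i hi => hne i (hmem i hi)) (fun i hi => hinj i (hmem i hi))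
      (fun i hi => hγ i (hmem i hi)) (fun i hi j hj => hd i (hmem i hi) j (hmem j hj))
    have has := Finset.mem_insert_self a s
    have hres : ∀ i ∈ s, ∃ t, (f i).comp (γ a) t ≠ 0 := by
      intro i hi
      obtain ⟨x, hx, hx'⟩ := hd a has i (hmem i hi) (fun h => ha (h ▸ hi))
      have : x ∈ range (γ a) := by rw [hγ a has]; exact hx
      obtain ⟨t, rfl⟩ := this
      exact ⟨t, hx'⟩
    set Z : Set V := {p | f a p = 0 ∧ ∃ i ∈ s, f i p = 0} with hZ
    have hZimage : Z = γ a '' {t | ∃ i ∈ s, (f i).comp (γ a) t = 0} := by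
      ext p
      constructor
      · rintro ⟨hp, hi⟩
        have : p ∈ range (γ a) := by rw [hγ a has]; exact hp
        obtain ⟨t, rfl⟩ := this
        exact ⟨t, hi, rfl⟩
      · rintro ⟨t, hi, rfl⟩
        have : γ a t ∈ range (γ a) := ⟨t, rfl⟩
        rw [hγ a has] at this
        exact ⟨this, hi⟩
    have hZf : Z.Finite := hZimage ▸ (finite_zeros hres).image _
    have hmult : (fun p => ((insert a s).filter fun i => f i p = 0).card - 1) =
        fun p => ((s.filter fun i => f i p = 0).card - 1) + Z.indicator (fun _ => 1) p := by
      funext p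
      rw [Finset.filter_insert]
      by_cases hp : f a p = 0
      · rw [if_pos hp, Finset.card_insert_of_notMem (by simp [ha])]
        by_cases hi : ∃ i ∈ s, f i p = 0
        · have hpos : 0 < (s.filter fun i => f i p = 0).card := by
            obtain ⟨i, hi, h0⟩ := hi
            exact Finset.card_pos.2 ⟨i, by simp [hi, h0]⟩
          rw [Set.indicator_of_mem (show p ∈ Z from ⟨hp, hi⟩)]
          omega
        · have hzero : (s.filter fun i => f i p = 0) = ∅ := by
            rw [Finset.filter_eq_empty_iff]
            exact fun i hi' h0 => hi ⟨i, hi', h0⟩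
          rw [Set.indicator_of_notMem (show p ∉ Z from fun h => hi h.2), hzero]
          simp
      · rw [if_neg hp, Set.indicator_of_notMem (show p ∉ Z from fun h => hp h.1), add_zero]
    have hindf : (Function.support (Z.indicator fun _ => (1 : ℕ))).Finite :=
      hZf.subset Set.support_indicator_subset
    rw [hmult]
    refine ⟨(ihf.union hindf).subset (Function.support_add _ _), ?_⟩
    rw [finsum_add_distrib ihf hindf, ncard_signPatterns_insert ha (hne a has), ih,
      Finset.card_insert_of_notMem ha, ← hγ a has, ← signPatterns_comp,
      ncard_signPatterns_line s hres]
    have hcard : ∑ᶠ p, Z.indicator (fun _ => 1) p =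
        {t | ∃ i ∈ s, (f i).comp (γ a) t = 0}.ncard := by
      rw [← Set.ncard_image_of_injective _ (hinj a has), ← hZimage, ← finsum_mem_def,
        finsum_one]
    rw [hcard]
    ring

end Counting

/-! ### Chambers -/

namespace AffineForm

/-- A real affine form as a Mathlib affine map. -/
def toAffineMap (f : AffineForm) : ℝ × ℝ →ᵃ[ℝ] ℝ :=
  (f.a • LinearMap.fst ℝ ℝ ℝ + f.b • LinearMap.snd ℝ ℝ ℝ).toAffineMap +
    AffineMap.const ℝ (ℝ × ℝ) f.c

@[simp] lemma toAffineMap_apply (f : AffineForm) (x : ℝ × ℝ) : f.toAffineMap x = f.eval x := by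
  simp [toAffineMap, eval]

lemma eval_lineMap (f : AffineForm) (x y : ℝ × ℝ) (c : ℝ) :
    f.eval (AffineMap.lineMap x y c) = (1 - c) * f.eval x + c * f.eval y := by
  rw [← toAffineMap_apply, AffineMap.lineMap_real_apply]
  simp only [toAffineMap_apply]

lemma continuous_eval (f : AffineForm) : Continuous f.eval := by
  unfold eval; fun_prop

lemma continuous_evalC (f : AffineForm) : Continuous f.evalC := by
  unfold evalC; fun_prop

@[simp] lemma evalC_realPoint (f : AffineForm) (x : ℝ × ℝ) :
    f.evalC (realPoint x) = (f.eval x : ℂ) := by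
  simp [evalC, realPoint, eval]

lemma eval_add_smul (f : AffineForm) (x v : ℝ × ℝ) (t : ℝ) :
    f.eval (x + t • v) = f.eval x + t * (f.a * v.1 + f.b * v.2) := by
  simp [eval]; ring

lemma convex_pos (f : AffineForm) (r : ℝ) : Convex ℝ {x | 0 < r * f.eval x} := by
  intro x hx y hy a b ha hb hab
  have hx : 0 < r * f.eval x := hx
  have hy : 0 < r * f.eval y := hy
  have h : f.eval (a • x + b • y) = a * f.eval x + b * f.eval y := by
    obtain rfl : a = 1 - b := by linarith
    rw [← f.eval_lineMap, AffineMap.lineMap_apply_module]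
  change 0 < r * f.eval (a • x + b • y)
  rw [h]
  rcases ha.eq_or_lt with rfl | ha
  · obtain rfl : b = 1 := by linarith
    simpa using hy
  · nlinarith [mul_pos ha hx, mul_nonneg hb hy.le]

end AffineForm

lemma realPoint_injective : Function.Injective realPoint := by
  intro x y h
  simpa [realPoint, Prod.ext_iff] using h

lemma continuous_realPoint : Continuous realPoint := by
  unfold realPoint; fun_prop

lemma realPoint_re {z : ℂ × ℂ} (h1 : z.1.im = 0) (h2 : z.2.im = 0) :
    realPoint (z.1.re, z.2.re) = z :=
  Prod.ext (Complex.ext (by simp [realPoint]) (by simp [realPoint, h1]))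
    (Complex.ext (by simp [realPoint]) (by simp [realPoint, h2]))

lemma mem_range_realPoint {z : ℂ × ℂ} : z ∈ range realPoint ↔ z.1.im = 0 ∧ z.2.im = 0 := by
  constructor
  · rintro ⟨x, rfl⟩; simp [realPoint]
  · rintro ⟨h1, h2⟩
    exact ⟨_, realPoint_re h1 h2⟩

namespace LineArrangement

variable {n : ℕ} (A : LineArrangement n)

/-- The points on the same side of every line as `x`. -/
def cell (x : ℝ × ℝ) : Set (ℝ × ℝ) := {y | ∀ i, 0 < (A.form i).eval x * (A.form i).eval y}

lemma convex_cell (x : ℝ × ℝ) : Convex ℝ (A.cell x) := by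
  have : A.cell x = ⋂ i, {y | 0 < (A.form i).eval x * (A.form i).eval y} := by
    ext; simp [cell]
  rw [this]
  exact convex_iInter fun i => (A.form i).convex_pos _

lemma isOpen_cell (x : ℝ × ℝ) : IsOpen (A.cell x) := by
  have : A.cell x = ⋂ i, {y | 0 < (A.form i).eval x * (A.form i).eval y} := by
    ext; simp [cell]
  rw [this]
  exact isOpen_iInter_of_finite fun i =>
    isOpen_lt continuous_const (continuous_const.mul (A.form i).continuous_eval)

variable {A}

lemma cell_subset {x : ℝ × ℝ} : A.cell x ⊆ A.realComplement := fun y hy i h0 => by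
  have := hy i
  simp [h0] at this

lemma self_mem_cell {x : ℝ × ℝ} (hx : x ∈ A.realComplement) : x ∈ A.cell x :=
  fun i => mul_self_pos.2 (hx i)

lemma mem_cell_symm {x y : ℝ × ℝ} (h : y ∈ A.cell x) : x ∈ A.cell y :=
  fun i => by simpa [mul_comm] using h i

lemma mul_pos_trans {a b c : ℝ} (h1 : 0 < a * b) (h2 : 0 < b * c) : 0 < a * c := by
  have hb : b ≠ 0 := by rintro rfl; simp at h1
  have h3 : 0 < b * b := mul_self_pos.2 hb
  have : 0 < (a * c) * (b * b) := by nlinarith [mul_pos h1 h2]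
  exact (pos_iff_pos_of_mul_pos this).2 h3

lemma cell_eq_of_mem {x y : ℝ × ℝ} (h : y ∈ A.cell x) : A.cell y = A.cell x := by
  ext z
  exact ⟨fun hz i => mul_pos_trans (h i) (hz i),
    fun hz i => mul_pos_trans (mem_cell_symm h i) (hz i)⟩

lemma connectedComponentIn_eq_cell {x : ℝ × ℝ} (hx : x ∈ A.realComplement) :
    connectedComponentIn A.realComplement x = A.cell x := by
  refine Subset.antisymm ?_ ?_
  · intro y hy i
    have hy' := connectedComponentIn_subset _ _ hy
    by_contra hneg
    have hpre := isPreconnected_connectedComponentIn (x := x) (F := A.realComplement)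
    have hxm := mem_connectedComponentIn hx
    have hcont := (A.form i).continuous_eval.continuousOn
      (s := connectedComponentIn A.realComplement x)
    have key : (0 : ℝ) ∈ (A.form i).eval '' connectedComponentIn A.realComplement x := by
      rcases lt_or_gt_of_ne (hx i) with h1 | h1 <;> rcases lt_or_gt_of_ne (hy' i) with h2 | h2
      · exact absurd (mul_pos_of_neg_of_neg h1 h2) hneg
      · exact hpre.intermediate_value hxm hy hcont ⟨h1.le, h2.le⟩
      · exact hpre.intermediate_value hy hxm hcont ⟨h2.le, h1.le⟩
      · exact absurd (mul_pos h1 h2) hneg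
    obtain ⟨z, hz, h0⟩ := key
    exact connectedComponentIn_subset _ _ hz i h0
  · exact (A.convex_cell x).isPreconnected.subset_connectedComponentIn (self_mem_cell hx)
      cell_subset

lemma mem_chambers {C : Set (ℝ × ℝ)} :
    C ∈ A.chambers ↔ ∃ x ∈ A.realComplement, C = A.cell x := by
  constructor
  · rintro ⟨x, hx, rfl⟩
    exact ⟨x, hx, connectedComponentIn_eq_cell hx⟩
  · rintro ⟨x, hx, rfl⟩
    exact ⟨x, hx, (connectedComponentIn_eq_cell hx).symm⟩

lemma eq_cell_of_mem {C : Set (ℝ × ℝ)} (hC : C ∈ A.chambers) {x : ℝ × ℝ} (hx : x ∈ C) :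
    C = A.cell x := by
  obtain ⟨y, hy, rfl⟩ := mem_chambers.1 hC
  exact (cell_eq_of_mem hx).symm

lemma cell_mem_chambers {x : ℝ × ℝ} (hx : x ∈ A.realComplement) : A.cell x ∈ A.chambers :=
  mem_chambers.2 ⟨x, hx, rfl⟩

lemma disjoint_chambers {C D : Set (ℝ × ℝ)} (hC : C ∈ A.chambers) (hD : D ∈ A.chambers)
    (h : C ≠ D) : Disjoint C D := by
  rw [Set.disjoint_left]
  intro x hx hx'
  exact h ((eq_cell_of_mem hC hx).trans (eq_cell_of_mem hD hx').symm)

lemma realPoint_mem_complement {x : ℝ × ℝ} : realPoint x ∈ A.complement ↔ x ∈ A.realComplement := by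
  simp [complement, realComplement]

/-- Two distinct lines meet in at most one point. -/
lemma eq_of_mem_two_lines {i j : Fin n} (hij : i ≠ j) {p q : ℝ × ℝ}
    (hp : (A.form i).eval p = 0) (hp' : (A.form j).eval p = 0)
    (hq : (A.form i).eval q = 0) (hq' : (A.form j).eval q = 0) : p = q := by
  by_contra hpq
  apply hij
  apply A.distinct
  simp only
  have key : ∀ f g : AffineForm, (f.a, f.b) ≠ ((0, 0) : ℝ × ℝ) → f.eval p = 0 → f.eval q = 0 →
      g.eval p = 0 → g.eval q = 0 → ∀ x, f.eval x = 0 → g.eval x = 0 := by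
    intro f g hf fp fq gp gq x fx
    unfold AffineForm.eval at *
    -- both gradients are orthogonal to the nonzero vector `p - q`
    have h1 : f.a * (p.1 - q.1) + f.b * (p.2 - q.2) = 0 := by linarith
    have h2 : g.a * (p.1 - q.1) + g.b * (p.2 - q.2) = 0 := by linarith
    have hdet : f.a * g.b - f.b * g.a = 0 := by
      by_contra hd
      apply hpq
      have e1 : (f.a * g.b - f.b * g.a) * (p.1 - q.1) = 0 := by
        linear_combination g.b * h1 - f.b * h2
      have e2 : (f.a * g.b - f.b * g.a) * (p.2 - q.2) = 0 := by
        linear_combination f.a * h2 - g.a * h1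
      ext
      · linarith [(mul_eq_zero.1 e1).resolve_left hd]
      · linarith [(mul_eq_zero.1 e2).resolve_left hd]
    have h3 : f.a * (x.1 - p.1) + f.b * (x.2 - p.2) = 0 := by linarith
    have h4 : f.a * (g.a * (x.1 - p.1) + g.b * (x.2 - p.2)) = 0 := by
      linear_combination g.a * h3 + (x.2 - p.2) * hdet
    have h5 : f.b * (g.a * (x.1 - p.1) + g.b * (x.2 - p.2)) = 0 := by
      linear_combination g.b * h3 - (x.1 - p.1) * hdet
    have h6 : g.a * (x.1 - p.1) + g.b * (x.2 - p.2) = 0 := by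
      rcases mul_eq_zero.1 h4 with ha | h
      · rcases mul_eq_zero.1 h5 with hb | h
        · exact absurd (by rw [ha, hb]) hf
        · exact h
      · exact h
    linarith
  ext x
  exact ⟨key _ _ (A.nondeg i) hp hq hp' hq' x, key _ _ (A.nondeg j) hp' hq' hp hq x⟩

/-- A parametrization of the `i`-th line: the foot of the perpendicular from the origin, plus
multiples of the rotated gradient. -/
def lineParam (A : LineArrangement n) (i : Fin n) : ℝ →ᵃ[ℝ] ℝ × ℝ :=
  AffineMap.lineMap
    (-(A.form i).c / ((A.form i).a ^ 2 + (A.form i).b ^ 2) * (A.form i).a,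
      -(A.form i).c / ((A.form i).a ^ 2 + (A.form i).b ^ 2) * (A.form i).b)
    (-(A.form i).c / ((A.form i).a ^ 2 + (A.form i).b ^ 2) * (A.form i).a - (A.form i).b,
      -(A.form i).c / ((A.form i).a ^ 2 + (A.form i).b ^ 2) * (A.form i).b + (A.form i).a)

lemma normSq_pos (A : LineArrangement n) (i : Fin n) :
    0 < (A.form i).a ^ 2 + (A.form i).b ^ 2 := by
  have h := A.nondeg i
  rw [Ne, Prod.mk.injEq, not_and_or] at h
  rcases h with h | h <;> positivity

lemma range_lineParam (A : LineArrangement n) (i : Fin n) :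
    range (A.lineParam i) = {x | (A.form i).toAffineMap x = 0} := by
  have hpos := A.normSq_pos i
  ext x
  simp only [AffineForm.toAffineMap_apply, mem_ofPred_eq, lineParam]
  constructor
  · rintro ⟨t, rfl⟩
    rw [AffineForm.eval_lineMap]
    unfold AffineForm.eval
    field_simp
    ring
  · intro h
    unfold AffineForm.eval at h
    refine ⟨((A.form i).a * x.2 - (A.form i).b * x.1) / ((A.form i).a ^ 2 + (A.form i).b ^ 2), ?_⟩
    rw [AffineMap.lineMap_apply_module]
    have hc : (A.form i).c = - ((A.form i).a * x.1 + (A.form i).b * x.2) := by linarith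
    ext
    · simp only [hc, Prod.smul_mk, smul_eq_mul, Prod.mk_add_mk]
      field_simp
      ring
    · simp only [hc, Prod.smul_mk, smul_eq_mul, Prod.mk_add_mk]
      field_simp
      ring

lemma lineParam_injective (A : LineArrangement n) (i : Fin n) :
    Function.Injective (A.lineParam i) := by
  apply AffineMap.lineMap_injective
  intro h
  rw [Prod.mk.injEq] at h
  apply A.nondeg i
  ext <;> simp <;> linarith [h.1, h.2]

/-- Neither of two distinct lines contains the other. -/
lemma exists_mem_line_notMem_line {i j : Fin n} (hij : i ≠ j) :
    ∃ x, (A.form i).eval x = 0 ∧ (A.form j).eval x ≠ 0 := by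
  by_contra! h
  have hmem : ∀ t, (A.form i).eval (A.lineParam i t) = 0 := fun t => by
    have : A.lineParam i t ∈ range (A.lineParam i) := ⟨t, rfl⟩
    rw [range_lineParam] at this
    simpa using this
  have := eq_of_mem_two_lines hij (hmem 0) (h _ (hmem 0)) (hmem 1) (h _ (hmem 1))
  exact zero_ne_one (A.lineParam_injective i this)

lemma finite_intersections (A : LineArrangement n) : A.intersections.Finite := by
  have : A.intersections = ⋃ i, ⋃ j,
      {p | i ≠ j ∧ (A.form i).eval p = 0 ∧ (A.form j).eval p = 0} := by
    ext; simp [intersections]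
  rw [this]
  refine finite_iUnion fun i => finite_iUnion fun j => Set.Subsingleton.finite ?_
  rintro p ⟨hij, hp, hp'⟩ q ⟨-, hq, hq'⟩
  exact eq_of_mem_two_lines hij hp hp' hq hq'

/-- The number of chambers of the arrangement, in terms of sign patterns. -/
lemma ncard_signPatterns (A : LineArrangement n) :
    (signPatterns (fun i => (A.form i).toAffineMap) Finset.univ univ).ncard =
      1 + n + ∑ᶠ p ∈ A.intersections, (A.mult p - 1) := by
  classical
  have h := (ncard_signPatterns_lines (f := fun i => (A.form i).toAffineMap) Finset.univ ?_
    A.lineParam (fun i _ => A.lineParam_injective i) (fun i _ => A.range_lineParam i) ?_).2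
  · rw [h, Finset.card_fin]
    have hm : ∀ p, (Finset.univ.filter fun i => (A.form i).toAffineMap p = 0).card = A.mult p := by
      intro p
      rw [mult, ← Set.ncard_coe_finset]
      simp
    simp only [hm]
    congr 1
    rw [finsum_mem_def]
    refine finsum_congr fun p => ?_
    by_cases hp : p ∈ A.intersections
    · rw [Set.indicator_of_mem hp]
    · rw [Set.indicator_of_notMem hp]
      have : A.mult p ≤ 1 := by
        rw [mult, Set.ncard_le_one]
        intro i hi j hj
        by_contra hij
        exact hp ⟨i, j, hij, hi, hj⟩
      omega
  · intro i _
    by_contra! hz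
    have h0 := hz (0, 0)
    have h1 := hz (1, 0)
    have h2 := hz (0, 1)
    simp [AffineForm.eval] at h0 h1 h2
    apply A.nondeg i
    ext <;> simp <;> linarith
  · intro i _ j _ hij
    simpa using exists_mem_line_notMem_line hij

namespace NumberedFlag

variable (F : A.NumberedFlag)

/-- The line of the flag meets as many cells as there are lines, and one more. -/
lemma ncard_signPatterns_space_one :
    (signPatterns (fun i => (A.form i).toAffineMap) Finset.univ (F.space 1)).ncard = n + 1 := by
  classical
  have hr : F.space 1 = range (AffineMap.lineMap F.base (F.base + F.dir) : ℝ →ᵃ[ℝ] ℝ × ℝ) := by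
    simp only [space]
    norm_num
    congr 1
    funext t
    rw [AffineMap.lineMap_apply_module']
    simp [add_comm]
  have hval : ∀ i t, ((A.form i).toAffineMap.comp
      (AffineMap.lineMap F.base (F.base + F.dir) : ℝ →ᵃ[ℝ] ℝ × ℝ)) t = 0 ↔ t = F.pos i := by
    intro i t
    rw [← F.eval_eq_zero_iff, AffineMap.comp_apply, AffineForm.toAffineMap_apply,
      AffineMap.lineMap_apply_module']
    simp [add_comm]
  rw [hr, ← signPatterns_comp, ncard_signPatterns_line Finset.univ]
  · simp only [hval, Finset.mem_univ, true_and]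
    have : {x | ∃ i, x = F.pos i} = range F.pos := by ext; simp [eq_comm]
    rw [this, ← image_univ, Set.ncard_image_of_injective _ F.pos_strictAnti.injective]
    simp
  · intro i _
    exact ⟨F.pos i + 1, fun h => by simpa using (hval i _).1 h⟩

lemma mem_ch_two {C : Set (ℝ × ℝ)} : C ∈ F.ch 2 ↔ C ∈ A.chambers ∧ C ∩ F.space 1 = ∅ := by
  simp only [ch, mem_ofPred_eq]
  norm_num
  intro hC _
  obtain ⟨x, hx, rfl⟩ := mem_chambers.1 hC
  exact ⟨x, self_mem_cell hx, by simp [space]⟩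

lemma cell_mem_ch_two {x : ℝ × ℝ} (hx : x ∈ A.realComplement) :
    A.cell x ∈ F.ch 2 ↔ ∀ y ∈ F.space 1, y ∉ A.cell x := by
  rw [mem_ch_two, and_iff_right (cell_mem_chambers hx), Set.eq_empty_iff_forall_notMem]
  exact ⟨fun h y hy hy' => h y ⟨hy', hy⟩, fun h y hy => h y hy.2 hy.1⟩

/-- The number of chambers that do not meet the line of the flag. -/
theorem ncard_ch_two :
    (F.ch 2).Finite ∧ (F.ch 2).ncard = ∑ᶠ p ∈ A.intersections, (A.mult p - 1) := by
  classical
  set f : Fin n → ℝ × ℝ →ᵃ[ℝ] ℝ := fun i => (A.form i).toAffineMap with hf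
  set R := signPatterns f Finset.univ univ with hR
  set R₁ := signPatterns f Finset.univ (F.space 1) with hR₁
  have hsub : R₁ ⊆ R := by
    rintro _ ⟨x, ⟨-, hx⟩, rfl⟩
    exact ⟨x, ⟨mem_univ _, hx⟩, rfl⟩
  have hRf : R.Finite := finite_signPatterns _
  set Q : Finset (Fin n) → Set (ℝ × ℝ) := fun T =>
    {x | x ∈ A.realComplement ∧ signPattern f Finset.univ x = T} with hQ
  have hmem : ∀ x, x ∈ A.realComplement ↔ ∀ i ∈ Finset.univ, f i x ≠ 0 := by
    intro x; simp [realComplement, hf]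
  have hQcell : ∀ x ∈ A.realComplement, Q (signPattern f Finset.univ x) = A.cell x := by
    intro x hx
    ext y
    constructor
    · rintro ⟨hy, h⟩ i
      have := (signPattern_eq_iff ((hmem x).1 hx) ((hmem y).1 hy)).1 h.symm i (Finset.mem_univ i)
      simpa [hf] using this
    · intro hy
      have hy' := cell_subset hy
      refine ⟨hy', ((signPattern_eq_iff ((hmem x).1 hx) ((hmem y).1 hy')).2 ?_).symm⟩
      intro i _
      simpa [hf] using hy i
  have himage : F.ch 2 = Q '' (R \ R₁) := by
    ext C
    constructor
    · intro hC
      obtain ⟨x, hx, rfl⟩ := mem_chambers.1 ((mem_ch_two F).1 hC).1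
      refine ⟨signPattern f Finset.univ x, ⟨⟨x, ⟨mem_univ _, (hmem x).1 hx⟩, rfl⟩, ?_⟩, hQcell x hx⟩
      rintro ⟨y, ⟨hy, hy'⟩, hxy⟩
      apply (F.cell_mem_ch_two hx).1 hC y hy
      rw [← hQcell x hx]
      exact ⟨(hmem y).2 hy', hxy⟩
    · rintro ⟨_, ⟨⟨x, ⟨-, hx⟩, rfl⟩, hn⟩, rfl⟩
      have hx' := (hmem x).2 hx
      rw [hQcell x hx', F.cell_mem_ch_two hx']
      intro y hy hyc
      apply hn
      rw [← hQcell x hx'] at hyc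
      exact ⟨y, ⟨hy, (hmem y).1 hyc.1⟩, hyc.2⟩
  have hinj : InjOn Q (R \ R₁) := by
    rintro _ ⟨⟨x, ⟨-, hx⟩, rfl⟩, -⟩ T - h
    have : x ∈ Q T := h ▸ ⟨(hmem x).2 hx, rfl⟩
    exact this.2
  refine ⟨himage ▸ (hRf.subset sdiff_subset).image _, ?_⟩
  have hcount := Set.ncard_sdiff_add_ncard_of_subset hsub hRf
  have h1 : R.ncard = _ := A.ncard_signPatterns
  have h2 : R₁.ncard = _ := F.ncard_signPatterns_space_one
  rw [himage, hinj.ncard_image]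
  omega

end NumberedFlag

end LineArrangement

/-! ### A criterion for contractibility -/

/-- A subset of a vector space is contractible if each of its points can be joined by a segment in
it to the image of the point under a map that factors through a contractible space. -/
lemma contractibleSpace_of_segment {E Y : Type*} [AddCommGroup E] [Module ℝ E] [TopologicalSpace E]
    [IsTopologicalAddGroup E] [ContinuousSMul ℝ E] [TopologicalSpace Y] [ContractibleSpace Y]
    {S : Set E} (f : S → Y) (hf : Continuous f) (g : Y → E) (hg : Continuous g)
    (hgS : ∀ y, g y ∈ S)
    (h : ∀ z : S, ∀ c ∈ Icc (0 : ℝ) 1, (1 - c) • (z : E) + c • g (f z) ∈ S) :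
    ContractibleSpace S := by
  rw [contractible_iff_id_nullhomotopic]
  let f' : C(S, Y) := ⟨f, hf⟩
  let g' : C(Y, S) := ⟨fun y => ⟨g y, hgS y⟩, hg.subtype_mk _⟩
  have hnull : (g'.comp f').Nullhomotopic := by
    have := ((id_nullhomotopic Y).comp_left f').comp_right g'
    simpa using this
  obtain ⟨p, hp⟩ := hnull
  refine ⟨p, ContinuousMap.Homotopic.trans ⟨?_⟩ hp⟩
  refine ⟨⟨fun q => ⟨(1 - (q.1 : ℝ)) • (q.2 : E) + (q.1 : ℝ) • g (f q.2), h q.2 q.1 q.1.2⟩, ?_⟩,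
    ?_, ?_⟩
  · refine Continuous.subtype_mk ?_ _
    have := hg.comp hf
    fun_prop
  · intro z; ext1; simp
  · intro z; ext1; simp [f', g']

/-! ### The forms in coordinates adapted to the flag -/

/-- `a` and `b` are negative real multiples of each other, or both zero. -/
def AreOpposite (a b : ℂ) : Prop := ∃ ρ : ℝ, 0 < ρ ∧ a + ρ * b = 0

lemma areOpposite_mul_iff {a b : ℂ} {c d : ℝ} (hc : 0 < c) (hd : 0 < d) :
    AreOpposite (c * a) (d * b) ↔ AreOpposite a b := by
  constructor
  · rintro ⟨ρ, hρ, h⟩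
    refine ⟨ρ * d / c, by positivity, ?_⟩
    have hc' : (c : ℂ) ≠ 0 := by exact_mod_cast hc.ne'
    push_cast
    field_simp
    linear_combination h
  · rintro ⟨ρ, hρ, h⟩
    refine ⟨ρ * c / d, by positivity, ?_⟩
    have hd' : (d : ℂ) ≠ 0 := by exact_mod_cast hd.ne'
    push_cast
    field_simp
    linear_combination c * h

namespace Sweep

variable {n : ℕ}

/-- The coefficients of the first coordinate in the forms `-1, x - tᵢ - sᵢ y`. -/
def lead : Fin (n + 1) → ℝ := Fin.cons 0 fun _ => 1

/-- The real form `-1` or `X - tᵢ` on the line of the flag. -/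
def lineForm (t : Fin n → ℝ) (k : Fin (n + 1)) (X : ℝ) : ℝ :=
  lead k * X - (Fin.cons 1 t : Fin (n + 1) → ℝ) k

/-- The forms `-1, x - t₁ - s₁ y, …, x - tₙ - sₙ y` on `ℂ²`, where `y = 0` is the line of the
flag. -/
def form (t s : Fin n → ℝ) (k : Fin (n + 1)) (z : ℂ × ℂ) : ℂ :=
  lead k * z.1 - (Fin.cons 1 t : Fin (n + 1) → ℝ) k - (Fin.cons 0 s : Fin (n + 1) → ℝ) k * z.2

variable {t s : Fin n → ℝ}

@[simp] lemma lead_succ (i : Fin n) : lead i.succ = 1 := rfl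
@[simp] lemma lineForm_zero (X : ℝ) : lineForm t 0 X = -1 := by simp [lineForm, lead]
@[simp] lemma lineForm_succ (i : Fin n) (X : ℝ) : lineForm t i.succ X = X - t i := by
  simp [lineForm, lead]
@[simp] lemma form_zero (z : ℂ × ℂ) : form t s 0 z = -1 := by simp [form, lead]
@[simp] lemma form_succ (i : Fin n) (z : ℂ × ℂ) : form t s i.succ z = z.1 - t i - s i * z.2 := by
  simp [form, lead]

lemma lead_nonneg (k : Fin (n + 1)) : 0 ≤ lead k := by
  cases k using Fin.cases <;> simp [lead]

lemma continuous_form (k : Fin (n + 1)) : Continuous (form t s k) := by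
  unfold form; fun_prop

lemma form_combo (k : Fin (n + 1)) (z w : ℂ × ℂ) (c : ℝ) :
    form t s k ((1 - c) • z + c • w) = (1 - c) * form t s k z + c * form t s k w := by
  simp [form]; ring

lemma form_real (k : Fin (n + 1)) (X : ℝ) : form t s k ((X : ℂ), 0) = lineForm t k X := by
  simp [form, lineForm]

/-- If `w = Im y ≠ 0`, then the points of the plane on the real line through `Re z` with direction
`Im z` are the `Re z + c Im z`; one of them is on the line `y = 0` of the flag, and this is its
first coordinate. -/
def foot (z : ℂ × ℂ) : ℝ := z.1.re - z.2.re / z.2.im * z.1.im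

lemma lineForm_foot {z : ℂ × ℂ} (hz : z.2.im ≠ 0) (k : Fin (n + 1)) :
    lineForm t k (foot z) = (form t s k z).re - z.2.re / z.2.im * (form t s k z).im := by
  simp [lineForm, form, foot]
  field_simp
  ring

/-- On the line of the flag, two consecutive forms have opposite signs only between their zeros,
and there the signs of all forms are known. -/
lemma lineForm_signs (ht : StrictAnti t) {i : Fin n} {X ρ : ℝ} (hρ : 0 < ρ)
    (h : lineForm t i.castSucc X + ρ * lineForm t i.succ X = 0) (k : Fin (n + 1)) :
    (k ≤ i.castSucc → lineForm t k X < 0) ∧ (i.succ ≤ k → 0 < lineForm t k X) := by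
  have hmono : ∀ a b : Fin (n + 1), a ≠ 0 → a < b → lineForm t a X < lineForm t b X := by
    intro a b ha hab
    cases a using Fin.cases with
    | zero => exact absurd rfl ha
    | succ a =>
      cases b using Fin.cases with
      | zero => simp at hab
      | succ b =>
        have := ht (Fin.succ_lt_succ_iff.1 hab)
        simp only [lineForm_succ]; linarith
  have hi : lineForm t i.castSucc X < 0 ∧ 0 < lineForm t i.succ X := by
    by_cases h0 : i.castSucc = 0
    · rw [h0, lineForm_zero] at h ⊢
      refine ⟨by norm_num, ?_⟩
      by_contra hn
      nlinarith
    · have hlt := hmono _ _ h0 (Fin.castSucc_lt_succ (i := i))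
      constructor
      · by_contra hn
        nlinarith
      · by_contra hn
        nlinarith
  constructor
  · intro hk
    by_cases h0 : k = 0
    · simp [h0]
    · rcases hk.eq_or_lt with rfl | hk
      · exact hi.1
      · exact (hmono _ _ h0 hk).trans hi.1
  · intro hk
    rcases hk.eq_or_lt with rfl | hk
    · exact hi.2
    · exact hi.2.trans (hmono _ _ (Fin.succ_ne_zero i) hk)

/-- The signs that the forms take on the line of the flag between the zeros of two consecutive
forms. -/
def Signs (t s : Fin n → ℝ) (i : Fin n) (z : ℂ × ℂ) : Prop :=
  ∀ k : Fin (n + 1), (k ≤ i.castSucc → (form t s k z).re < 0) ∧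
    (i.succ ≤ k → 0 < (form t s k z).re)

lemma foot_signs (ht : StrictAnti t) {i : Fin n} {z : ℂ × ℂ} (hz : z.2.im ≠ 0)
    (h : AreOpposite (form t s i.castSucc z) (form t s i.succ z)) (k : Fin (n + 1)) :
    (k ≤ i.castSucc → lineForm t k (foot z) < 0) ∧ (i.succ ≤ k → 0 < lineForm t k (foot z)) := by
  obtain ⟨ρ, hρ, h⟩ := h
  refine lineForm_signs ht hρ ?_ k
  have hre := congrArg Complex.re h
  have him := congrArg Complex.im h
  simp [-form_succ] at hre him
  rw [lineForm_foot (s := s) hz, lineForm_foot (s := s) hz]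
  linear_combination hre - z.2.re / z.2.im * him

/-- Outside `Im y = 0`, no form vanishes on a sail. -/
lemma form_ne_zero_of_opposite (ht : StrictAnti t) {i : Fin n} {z : ℂ × ℂ} (hz : z.2.im ≠ 0)
    (h : AreOpposite (form t s i.castSucc z) (form t s i.succ z)) (k : Fin (n + 1)) :
    form t s k z ≠ 0 := by
  intro h0
  have h1 := foot_signs ht hz h k
  rw [lineForm_foot (s := s) hz, h0] at h1
  simp only [Complex.zero_re, Complex.zero_im, mul_zero, sub_zero, lt_self_iff_false,
    imp_false, not_le] at h1
  exact absurd (Fin.castSucc_lt_iff_succ_le.1 h1.1) (not_le.2 h1.2)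

/-- Outside `Im y = 0`, the sails are disjoint. -/
lemma eq_of_opposite {s : Fin n → ℝ} (ht : StrictAnti t) {i j : Fin n} {z : ℂ × ℂ} (hz : z.2.im ≠ 0)
    (hi : AreOpposite (form t s i.castSucc z) (form t s i.succ z))
    (hj : AreOpposite (form t s j.castSucc z) (form t s j.succ z)) : i = j := by
  have key : ∀ i j : Fin n, i < j → AreOpposite (form t s i.castSucc z) (form t s i.succ z) →
      AreOpposite (form t s j.castSucc z) (form t s j.succ z) → False := by
    intro i j hij hi hj
    have h1 := (foot_signs ht hz hi i.succ).2 le_rfl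
    have h2 := (foot_signs ht hz hj i.succ).1 (Fin.castSucc_lt_iff_succ_le.1
      (Fin.castSucc_lt_castSucc_iff.2 hij))
    exact lt_asymm h1 h2
  rcases lt_trichotomy i j with h | h | h
  · exact (key i j h hi hj).elim
  · exact h
  · exact (key j i h hj hi).elim

/-- The points of a sail with `Im y = 0` are real. -/
lemma im_eq_zero_of_opposite {i : Fin n} {z : ℂ × ℂ} (hz : z.2.im = 0)
    (h : AreOpposite (form t s i.castSucc z) (form t s i.succ z)) : z.1.im = 0 := by
  obtain ⟨ρ, hρ, h⟩ := h
  have him := congrArg Complex.im h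
  simp [form, hz] at him
  have : (lead i.castSucc + ρ) * z.1.im = 0 := by linear_combination him
  exact (mul_eq_zero.1 this).resolve_left (by linarith [lead_nonneg i.castSucc])

/-! ### The pieces of the sails are contractible -/

/-- The piece of a sail, in sweep coordinates. -/
def sailPiece (t s : Fin n → ℝ) (i : Fin n) : Set (ℂ × ℂ) :=
  {z | AreOpposite (form t s i.castSucc z) (form t s i.succ z) ∧ (z.2.im ≠ 0 ∨ Signs t s i z)}

lemma form_succ_ne_zero_of_mem_sailPiece (ht : StrictAnti t) {i : Fin n} {z : ℂ × ℂ}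
    (hz : z ∈ sailPiece t s i) : form t s i.succ z ≠ 0 := by
  rcases hz.2 with h | h
  · exact form_ne_zero_of_opposite ht h hz.1 _
  · intro h0
    have := (h i.succ).2 le_rfl
    simp [h0] at this

/-- The point of the slice `Re y = 0` with `Im y = w` where the quotient of the two consecutive
forms is `-ρ`. -/
def slicePoint (t s : Fin n → ℝ) (i : Fin n) (q : ℝ × ℝ) : ℂ × ℂ :=
  (((Fin.cons 1 t : Fin (n + 1) → ℝ) i.castSucc + q.1 * t i +
      ((Fin.cons 0 s : Fin (n + 1) → ℝ) i.castSucc + q.1 * s i) * (q.2 * Complex.I)) /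
      ((lead i.castSucc + q.1 : ℝ) : ℂ), q.2 * Complex.I)

lemma slicePoint_relation {i : Fin n} {q : ℝ × ℝ} (hq : 0 < q.1) :
    form t s i.castSucc (slicePoint t s i q) + q.1 * form t s i.succ (slicePoint t s i q) = 0 := by
  have h : ((lead i.castSucc + q.1 : ℝ) : ℂ) ≠ 0 := by
    have := lead_nonneg i.castSucc
    exact_mod_cast (by linarith : lead i.castSucc + q.1 ≠ 0)
  have h' : (lead i.castSucc : ℂ) + q.1 ≠ 0 := by exact_mod_cast h
  simp only [form_succ]
  simp only [slicePoint, form, Complex.ofReal_add]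
  field_simp
  ring

lemma slicePoint_signs (ht : StrictAnti t) {i : Fin n} {q : ℝ × ℝ} (hq : 0 < q.1)
    (h0 : q.2 = 0) : Signs t s i (slicePoint t s i q) := by
  set X : ℝ := ((Fin.cons 1 t : Fin (n + 1) → ℝ) i.castSucc + q.1 * t i) /
    (lead i.castSucc + q.1) with hX
  have hs : slicePoint t s i q = ((X : ℂ), 0) := by
    simp [slicePoint, h0, hX]
  have hrel := slicePoint_relation (t := t) (s := s) (i := i) hq
  intro k
  rw [hs, form_real, form_real] at hrel
  rw [hs, form_real, Complex.ofReal_re]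
  exact lineForm_signs ht hq (by exact_mod_cast hrel) k

lemma exists_lineForm_signs (ht : StrictAnti t) (i : Fin n) : ∃ X, ∀ k : Fin (n + 1),
    (k ≤ i.castSucc → lineForm t k X < 0) ∧ (i.succ ≤ k → 0 < lineForm t k X) := by
  refine ⟨_, lineForm_signs ht one_pos
    (X := ((Fin.cons 1 t : Fin (n + 1) → ℝ) i.castSucc + t i) / (lead i.castSucc + 1)) ?_⟩
  have : lead i.castSucc + 1 ≠ 0 := by linarith [lead_nonneg i.castSucc]
  rw [lineForm_succ, lineForm]
  field_simp
  ring

theorem contractibleSpace_sailPiece (ht : StrictAnti t) (i : Fin n) :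
    ContractibleSpace (sailPiece t s i) := by
  have hconv : Convex ℝ (Ioi (0 : ℝ) ×ˢ (univ : Set ℝ)) := (convex_Ioi 0).prod convex_univ
  have : ContractibleSpace (Ioi (0 : ℝ) ×ˢ (univ : Set ℝ) : Set (ℝ × ℝ)) :=
    hconv.contractibleSpace ⟨(1, 0), by simp⟩
  have hρ : ∀ z ∈ sailPiece t s i, 0 < -(form t s i.castSucc z / form t s i.succ z).re ∧
      form t s i.castSucc z + (-(form t s i.castSucc z / form t s i.succ z).re : ℝ) *
        form t s i.succ z = 0 := by
    intro z hz
    have hne := form_succ_ne_zero_of_mem_sailPiece ht hz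
    obtain ⟨ρ, hρ, h⟩ := hz.1
    have hq : form t s i.castSucc z / form t s i.succ z = ((-ρ : ℝ) : ℂ) := by
      rw [div_eq_iff hne]; push_cast; linear_combination h
    rw [hq, Complex.ofReal_re, neg_neg]
    exact ⟨hρ, h⟩
  refine contractibleSpace_of_segment
    (Y := (Ioi (0 : ℝ) ×ˢ (univ : Set ℝ) : Set (ℝ × ℝ)))
    (fun z => ⟨(-(form t s i.castSucc z / form t s i.succ z).re, (z : ℂ × ℂ).2.im),
      ⟨(hρ z z.2).1, trivial⟩⟩) ?_ (fun q => slicePoint t s i q) ?_ ?_ ?_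
  · refine Continuous.subtype_mk ?_ _
    have h1 : Continuous fun z : sailPiece t s i => form t s i.castSucc z / form t s i.succ z :=
      ((continuous_form _).comp continuous_subtype_val).div
        ((continuous_form _).comp continuous_subtype_val)
        fun z => form_succ_ne_zero_of_mem_sailPiece ht z.2
    have h2 := Complex.continuous_re.comp h1
    have h3 : Continuous fun z : sailPiece t s i => (z : ℂ × ℂ).2.im :=
      Complex.continuous_im.comp (continuous_snd.comp continuous_subtype_val)
    exact h2.neg.prodMk h3
  · unfold slicePoint
    have hne : ∀ q : (Ioi (0 : ℝ) ×ˢ (univ : Set ℝ) : Set (ℝ × ℝ)),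
        ((lead i.castSucc + (q : ℝ × ℝ).1 : ℝ) : ℂ) ≠ 0 := by
      intro q
      have h1 := lead_nonneg i.castSucc
      have h2 : 0 < (q : ℝ × ℝ).1 := q.2.1
      exact_mod_cast (by linarith : lead i.castSucc + (q : ℝ × ℝ).1 ≠ 0)
    refine Continuous.prodMk (Continuous.div ?_ ?_ hne) ?_ <;> fun_prop
  · intro q
    have hq : 0 < (q : ℝ × ℝ).1 := q.2.1
    refine ⟨⟨_, hq, slicePoint_relation hq⟩, ?_⟩
    by_cases h0 : (q : ℝ × ℝ).2 = 0
    · exact Or.inr (slicePoint_signs ht hq h0)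
    · left; simpa [slicePoint] using h0
  · rintro ⟨z, hz⟩ c ⟨hc0, hc1⟩
    obtain ⟨hpos, hrel⟩ := hρ z hz
    set ρ := -(form t s i.castSucc z / form t s i.succ z).re
    have hrel' := slicePoint_relation (t := t) (s := s) (i := i) (q := (ρ, z.2.im)) hpos
    refine ⟨⟨ρ, hpos, ?_⟩, ?_⟩
    · simp only at hrel' ⊢
      rw [form_combo, form_combo]
      linear_combination (1 - (c : ℂ)) * hrel + c * hrel'
    · by_cases h0 : z.2.im = 0
      · right
        have hz2 := hz.2.resolve_left (not_not.2 h0)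
        have hsl := slicePoint_signs (s := s) ht (i := i) (q := (ρ, z.2.im)) hpos h0
        have hre : ∀ a b : ℂ, ((1 - c : ℂ) * a + c * b).re = (1 - c) * a.re + c * b.re := by
          intro a b; simp
        have hcomb : ∀ {a b : ℝ}, 0 < a → 0 < b → 0 < (1 - c) * a + c * b := by
          intro a b ha hb
          rcases hc0.eq_or_lt with rfl | hc
          · simpa using ha
          · nlinarith [mul_pos hc hb, mul_nonneg (sub_nonneg.2 hc1) ha.le]
        intro k
        simp only [form_combo, hre]
        refine ⟨fun hk => ?_, fun hk => hcomb ((hz2 k).2 hk) ((hsl k).2 hk)⟩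
        have := hcomb (neg_pos.2 ((hz2 k).1 hk)) (neg_pos.2 ((hsl k).1 hk))
        linarith
      · left
        simp only [slicePoint, Prod.snd_add, Prod.smul_snd, Complex.add_im, Complex.smul_im,
          Complex.mul_im, Complex.ofReal_re, Complex.I_im, mul_one, Complex.ofReal_im,
          Complex.I_re, mul_zero, add_zero, smul_eq_mul]
        convert h0 using 1
        ring

end Sweep

namespace Sweep

variable {n : ℕ} {t s : Fin n → ℝ}

/-! ### The complement of the sails is contractible -/

/-- The complement of the lines and of the sails, in sweep coordinates. -/
def openPiece (t s : Fin n → ℝ) : Set (ℂ × ℂ) :=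
  {z | (∀ k, form t s k z ≠ 0) ∧ ∀ i : Fin n, ¬ AreOpposite (form t s i.castSucc z)
    (form t s i.succ z)}

/-- Moving the real part of a point in the direction of its imaginary part. -/
def shear (r : ℝ) (z : ℂ × ℂ) : ℂ × ℂ := (z.1 + r * z.1.im, z.2 + r * z.2.im)

lemma form_shear (k : Fin (n + 1)) (r : ℝ) (z : ℂ × ℂ) :
    form t s k (shear r z) = form t s k z + r * (form t s k z).im := by
  apply Complex.ext <;> simp [form, shear]
  ring

/-- A shear acts on the values of all forms by the same real linear automorphism of `ℂ`, so it
preserves all sails. -/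
lemma shear_mem_openPiece {z : ℂ × ℂ} (hz : z ∈ openPiece t s) (r : ℝ) :
    shear r z ∈ openPiece t s := by
  constructor
  · intro k h
    apply hz.1 k
    rw [form_shear] at h
    have him := congrArg Complex.im h
    simp at him
    simpa [him] using h
  · rintro i ⟨ρ, hρ, h⟩
    refine hz.2 i ⟨ρ, hρ, ?_⟩
    rw [form_shear, form_shear] at h
    have him := congrArg Complex.im h
    simp [-form_succ] at him
    have him' : ((form t s i.castSucc z).im : ℂ) + ρ * (form t s i.succ z).im = 0 := by
      exact_mod_cast him
    linear_combination h - r * him'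

lemma mem_openPiece_of_re_neg {z : ℂ × ℂ} (h : ∀ k, (form t s k z).re < 0) :
    z ∈ openPiece t s := by
  constructor
  · intro k h0
    have := h k
    simp [h0] at this
  · rintro i ⟨ρ, hρ, h0⟩
    have hre := congrArg Complex.re h0
    simp [-form_succ] at hre
    nlinarith [h i.castSucc, h i.succ, mul_pos hρ (neg_pos.2 (h i.succ))]

/-- If the values of all forms but `-1` are strictly on one side of the real line, then no two
consecutive values are opposite. The sign of `σ` tells the side. -/
lemma mem_openPiece_of_im_pos {z : ℂ × ℂ} {σ : ℝ}
    (h : ∀ i : Fin n, 0 < σ * (form t s i.succ z).im) : z ∈ openPiece t s := by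
  constructor
  · intro k h0
    cases k using Fin.cases with
    | zero => simp at h0
    | succ i =>
      have := h i
      simp [h0, -form_succ] at this
  · rintro i ⟨ρ, hρ, h0⟩
    have him := congrArg Complex.im h0
    simp [-form_succ] at him
    have h1 : 0 ≤ σ * (form t s i.castSucc z).im := by
      generalize i.castSucc = k
      cases k using Fin.cases with
      | zero => simp
      | succ j => exact (h j).le
    have h2 := mul_pos hρ (h i)
    have : σ * (form t s i.castSucc z).im + ρ * (σ * (form t s i.succ z).im) = 0 := by
      linear_combination σ * him
    linarith

/-- The real points outside the sails form the chamber where all forms are negative. -/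
lemma re_neg_of_mem_openPiece {z : ℂ × ℂ} (hz : z ∈ openPiece t s) (h1 : z.1.im = 0)
    (h2 : z.2.im = 0) (k : Fin (n + 1)) : (form t s k z).re < 0 := by
  have him : ∀ k, (form t s k z).im = 0 := fun k => by simp [form, h1, h2]
  have hreal : ∀ k, form t s k z = ((form t s k z).re : ℂ) := fun k =>
    Complex.ext (by simp) (by simp [him])
  induction k using Fin.induction with
  | zero => simp
  | succ i ih =>
    by_contra hn
    have hpos : 0 < (form t s i.succ z).re := by
      refine lt_of_le_of_ne (not_lt.1 hn) fun h0 => hz.1 i.succ ?_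
      rw [hreal, ← h0]; simp
    refine hz.2 i ⟨-(form t s i.castSucc z).re / (form t s i.succ z).re,
      div_pos (neg_pos.2 ih) hpos, ?_⟩
    rw [hreal i.castSucc, hreal i.succ]
    simp only [Complex.ofReal_re]
    norm_cast
    field_simp
    ring

/-- A continuous function that is affine between given points, with given values there, and
constant to the right of the last of them. -/
lemma exists_interpolation : ∀ (m : ℕ) (t s : Fin (m + 1) → ℝ), StrictAnti t →
    ∃ G : ℝ → ℝ, Continuous G ∧ (∀ ξ, t 0 ≤ ξ → G ξ = s 0) ∧
      ∀ (i : Fin m) (ξ : ℝ), t i.succ ≤ ξ → ξ ≤ t i.castSucc →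
        (G ξ - s i.castSucc) * (t i.succ - t i.castSucc) =
          (s i.succ - s i.castSucc) * (ξ - t i.castSucc)
  | 0, _, s, _ => ⟨fun _ => s 0, continuous_const, fun _ _ => rfl, fun i => i.elim0⟩
  | m + 1, t, s, ht => by
    obtain ⟨G, hG, hG0, hG1⟩ := exists_interpolation m (fun i => t i.succ) (fun i => s i.succ)
      (fun i j hij => ht (Fin.succ_lt_succ_iff.2 hij))
    have h01 : t (Fin.succ 0) < t 0 := ht (Fin.succ_pos 0)
    have hd : 0 < t 0 - t (Fin.succ 0) := sub_pos.2 h01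
    refine ⟨fun ξ => G ξ + (s 0 - s (Fin.succ 0)) *
      max 0 (min 1 ((ξ - t (Fin.succ 0)) / (t 0 - t (Fin.succ 0)))), by fun_prop, ?_, ?_⟩
    · intro ξ hξ
      have h1 : 1 ≤ (ξ - t (Fin.succ 0)) / (t 0 - t (Fin.succ 0)) := by
        rw [le_div_iff₀ hd]; linarith
      simp only
      rw [min_eq_left h1, max_eq_right zero_le_one, hG0 ξ (h01.le.trans hξ)]
      ring
    · intro i ξ h1 h2
      simp only
      cases i using Fin.cases with
      | zero =>
        rw [Fin.castSucc_zero] at h2 ⊢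
        have hle : (ξ - t (Fin.succ 0)) / (t 0 - t (Fin.succ 0)) ≤ 1 := by
          rw [div_le_one hd]; linarith
        have hge : 0 ≤ (ξ - t (Fin.succ 0)) / (t 0 - t (Fin.succ 0)) :=
          div_nonneg (sub_nonneg.2 h1) hd.le
        rw [min_eq_right hle, max_eq_right hge, hG0 ξ h1]
        field_simp
        ring
      | succ i =>
        rw [← Fin.succ_castSucc] at h2 ⊢
        have hle : ξ ≤ t (Fin.succ 0) :=
          h2.trans (ht.antitone (Fin.succ_le_succ_iff.2 (Fin.zero_le _)))
        have hneg : (ξ - t (Fin.succ 0)) / (t 0 - t (Fin.succ 0)) ≤ 0 :=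
          div_nonpos_of_nonpos_of_nonneg (sub_nonpos.2 hle) hd.le
        rw [max_eq_left ((min_le_right _ _).trans hneg), mul_zero, add_zero]
        exact hG1 i ξ h1 h2

/-- In the slice `Re y = 0`, the complement of the lines and sails is the complement of graphs. -/
lemma exists_slice {m : ℕ} {t : Fin (m + 1) → ℝ} (s : Fin (m + 1) → ℝ) (ht : StrictAnti t) :
    ∃ G : ℝ → ℝ, Continuous G ∧ ∀ (x : ℂ) (w : ℝ),
      (x, (w * Complex.I : ℂ)) ∈ openPiece t s ↔
        ¬ (t (Fin.last m) ≤ x.re ∧ x.im = w * G x.re) := by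
  obtain ⟨G, hG, hG0, hG1⟩ := exists_interpolation m t s ht
  have hGt : ∀ k, G (t k) = s k := by
    intro k
    cases k using Fin.cases with
    | zero => exact hG0 _ le_rfl
    | succ j =>
      have hlt : t j.succ < t j.castSucc := ht Fin.castSucc_lt_succ
      have h := hG1 j (t j.succ) le_rfl hlt.le
      have := mul_right_cancel₀ (sub_ne_zero.2 hlt.ne) h
      linarith
  refine ⟨G, hG, fun x w => ?_⟩
  have hre : ∀ k : Fin (m + 1), (form t s k.succ (x, (w * Complex.I : ℂ))).re = x.re - t k := by
    intro k; simp
  have him : ∀ k : Fin (m + 1),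
      (form t s k.succ (x, (w * Complex.I : ℂ))).im = x.im - s k * w := by
    intro k; simp
  rw [iff_not_comm]
  constructor
  · -- the graph lies in the union of the lines and the sails
    rintro ⟨hx, hxi⟩ ⟨hz1, hz2⟩
    have hne : ∀ k, x.re ≠ t k := by
      intro k hk
      apply hz1 k.succ
      apply Complex.ext
      · rw [hre, hk]; simp
      · rw [him, hxi, hk, hGt]; simp [mul_comm]
    have hex : ∃ k, t k < x.re := ⟨_, lt_of_le_of_ne hx (hne _).symm⟩
    obtain ⟨k, hk, hmin⟩ := WellFounded.has_min (wellFounded_lt (α := Fin (m + 1)))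
      {k | t k < x.re} hex
    have hk : t k < x.re := hk
    cases k using Fin.cases with
    | zero =>
      refine hz2 0 ⟨1 / (x.re - t 0), by simpa using hk, ?_⟩
      have hval : form t s (Fin.succ 0) (x, (w * Complex.I : ℂ)) = ((x.re - t 0 : ℝ) : ℂ) := by
        apply Complex.ext
        · rw [hre]; simp
        · rw [him, hxi, hG0 _ hk.le]; simp [mul_comm]
      rw [hval, Fin.castSucc_zero, form_zero]
      have : x.re - t 0 ≠ 0 := by linarith
      norm_cast
      field_simp
      simp
    | succ j =>
      have hj : x.re < t j.castSucc := by
        refine lt_of_le_of_ne (not_lt.1 fun h => ?_) (hne _)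
        exact hmin j.castSucc h Fin.castSucc_lt_succ
      have hlin := hG1 j x.re hk.le hj.le
      have hpos : 0 < x.re - t j.succ := sub_pos.2 hk
      refine hz2 j.succ ⟨(t j.castSucc - x.re) / (x.re - t j.succ),
        div_pos (sub_pos.2 hj) hpos, ?_⟩
      rw [← Fin.succ_castSucc]
      apply Complex.ext
      · simp only [Complex.add_re, Complex.re_ofReal_mul, hre, Complex.zero_re]
        field_simp
        ring
      · simp only [Complex.add_im, Complex.im_ofReal_mul, him, Complex.zero_im, hxi]
        field_simp
        linear_combination -w * hlin
  · -- the lines and the sails lie on the graph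
    intro hz
    have hz' : (∃ k, form t s k (x, (w * Complex.I : ℂ)) = 0) ∨ ∃ i : Fin (m + 1),
        AreOpposite (form t s i.castSucc (x, (w * Complex.I : ℂ)))
          (form t s i.succ (x, (w * Complex.I : ℂ))) := by
      by_contra! h
      exact hz h
    have hlast : ∀ k, t (Fin.last m) ≤ t k := fun k => ht.antitone (Fin.le_last k)
    rcases hz' with ⟨k, hk⟩ | ⟨i, ρ, hρ, h⟩
    · cases k using Fin.cases with
      | zero => simp at hk
      | succ k =>
        have h1 := hre k
        have h2 := him k
        rw [hk] at h1 h2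
        simp only [Complex.zero_re, Complex.zero_im] at h1 h2
        have hxk : x.re = t k := by linarith
        refine ⟨hxk ▸ hlast k, ?_⟩
        rw [hxk, hGt]; linarith
    · cases i using Fin.cases with
      | zero =>
        rw [Fin.castSucc_zero, form_zero] at h
        have h1 := congrArg Complex.re h
        have h2 := congrArg Complex.im h
        simp only [Complex.add_re, Complex.add_im, Complex.re_ofReal_mul, Complex.im_ofReal_mul,
          hre, him, Complex.neg_re, Complex.neg_im, Complex.one_re, Complex.one_im,
          Complex.zero_re, Complex.zero_im] at h1 h2
        have hx0 : t 0 ≤ x.re := by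
          by_contra hn
          nlinarith
        refine ⟨(hlast 0).trans hx0, ?_⟩
        rw [hG0 _ hx0]
        have : ρ * (x.im - s 0 * w) = 0 := by linarith
        linarith [(mul_eq_zero.1 this).resolve_left hρ.ne']
      | succ j =>
        rw [← Fin.succ_castSucc] at h
        have h1 := congrArg Complex.re h
        have h2 := congrArg Complex.im h
        simp only [Complex.add_re, Complex.add_im, Complex.re_ofReal_mul, Complex.im_ofReal_mul,
          hre, him, Complex.zero_re, Complex.zero_im] at h1 h2
        have hlt : t j.succ < t j.castSucc := ht Fin.castSucc_lt_succ
        have hle1 : t j.succ ≤ x.re := by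
          by_contra hn
          nlinarith
        have hle2 : x.re ≤ t j.castSucc := by
          by_contra hn
          nlinarith
        refine ⟨(hlast _).trans hle1, ?_⟩
        have hlin := hG1 j x.re hle1 hle2
        have hd : (1 + ρ) * (t j.succ - t j.castSucc) ≠ 0 :=
          mul_ne_zero (by linarith) (sub_ne_zero.2 hlt.ne)
        have : (1 + ρ) * (t j.succ - t j.castSucc) * (x.im - w * G x.re) = 0 := by
          linear_combination (t j.succ - t j.castSucc) * h2 - (1 + ρ) * w * hlin
            - (s j.succ - s j.castSucc) * w * h1
        linarith [(mul_eq_zero.1 this).resolve_left hd]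

/-- The slit plane times a line. -/
lemma contractibleSpace_slit (r : ℝ) :
    ContractibleSpace {q : ℂ × ℝ | ¬ (r ≤ q.1.re ∧ q.1.im = 0)} := by
  refine StarConvex.contractibleSpace (x := (((r - 1 : ℝ) : ℂ), (0 : ℝ))) ?_
    ⟨(((r - 1 : ℝ) : ℂ), (0 : ℝ)), by simp⟩
  intro q hq a b ha hb hab
  rintro ⟨h1, h2⟩
  simp at h1 h2
  rcases hb.eq_or_lt with rfl | hb
  · obtain rfl : a = 1 := by linarith
    linarith
  · apply hq
    have : q.1.im = 0 := h2.resolve_left hb.ne'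
    refine ⟨?_, this⟩
    obtain rfl : a = 1 - b := by linarith
    nlinarith

theorem contractibleSpace_openPiece (ht : StrictAnti t) : ContractibleSpace (openPiece t s) := by
  cases n with
  | zero =>
    have : openPiece t s = univ := by
      rw [eq_univ_iff_forall]
      refine fun z => ⟨fun k => ?_, fun i => i.elim0⟩
      cases k using Fin.cases with
      | zero => simp
      | succ i => exact i.elim0
    rw [this]
    exact convex_univ.contractibleSpace ⟨0, trivial⟩
  | succ m =>
    obtain ⟨G, hG, hslice⟩ := exists_slice s ht
    -- a bound for the slopes: if `K * |Im y| < |Im x|`, then all forms have imaginary parts of the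
    -- same sign, and the real part of the point can be moved freely
    set K : ℝ := ∑ i, |s i| with hK
    have hsK : ∀ i, |s i| ≤ K := fun i =>
      Finset.single_le_sum (f := fun i => |s i|) (fun _ _ => abs_nonneg _) (Finset.mem_univ i)
    have hK0 : 0 ≤ K := (abs_nonneg _).trans (hsK 0)
    have hsw : ∀ i (w : ℝ), |s i * w| ≤ K * |w| := fun i w => by
      rw [abs_mul]; exact mul_le_mul_of_nonneg_right (hsK i) (abs_nonneg _)
    have hcre : ∀ k, Continuous fun z : openPiece t s => (form t s k z).re := fun k =>
      Complex.continuous_re.comp ((continuous_form k).comp continuous_subtype_val)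
    have hc1 : Continuous fun z : openPiece t s => (z : ℂ × ℂ).1 :=
      continuous_fst.comp continuous_subtype_val
    have hc2 : Continuous fun z : openPiece t s => (z : ℂ × ℂ).2 :=
      continuous_snd.comp continuous_subtype_val
    have hc1i := Complex.continuous_im.comp hc1
    have hc2i := Complex.continuous_im.comp hc2
    have hc2r := Complex.continuous_re.comp hc2
    simp only [Function.comp_def] at hc1i hc2i hc2r
    -- `χ` switches between two ways to move to the slice `Re y = 0`
    obtain ⟨χ, hχ0, hχ1, hχ⟩ := exists_continuous_zero_one_of_isClosed
      (s := {z : openPiece t s | (z : ℂ × ℂ).2.im = 0})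
      (t := {z : openPiece t s | |(z : ℂ × ℂ).1.im| ≤ K * |(z : ℂ × ℂ).2.im|} ∩
        ⋃ k, {z : openPiece t s | 0 ≤ (form t s k z).re})
      (isClosed_eq hc2i continuous_const)
      ((isClosed_le hc1i.abs (continuous_const.mul hc2i.abs)).inter
        (isClosed_iUnion_of_finite fun k => isClosed_le continuous_const (hcre k)))
      (by
        rw [Set.disjoint_left]
        rintro ⟨z, hz⟩ h2 ⟨h1, h⟩
        simp only [mem_ofPred_eq, mem_iUnion] at h1 h2 h
        obtain ⟨k, hk⟩ := h
        rw [h2, abs_zero, mul_zero] at h1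
        have h1' := abs_eq_zero.1 (le_antisymm h1 (abs_nonneg _))
        exact absurd (re_neg_of_mem_openPiece hz h1' h2 k) (not_lt.2 hk))
    -- the slope of the shear, truncated because it is unbounded near `Im y = 0`
    let cl : openPiece t s → ℝ := fun z =>
      max (-K) (min K ((z : ℂ × ℂ).1.im / (z : ℂ × ℂ).2.im))
    have hcl : ∀ z, |cl z| ≤ K := fun z =>
      abs_le.2 ⟨le_max_left _ _, max_le (by linarith) (min_le_left _ _)⟩
    have hχcl : Continuous fun z => χ z * cl z := by
      rw [continuous_iff_continuousAt]
      intro z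
      by_cases hz : (z : ℂ × ℂ).2.im = 0
      · have h0 : χ z = 0 := hχ0 hz
        have hlim : Filter.Tendsto (fun z => χ z * K) (𝓝 z) (𝓝 0) := by
          have := (χ.continuous.tendsto z).mul_const K
          rwa [h0, zero_mul] at this
        rw [ContinuousAt, h0, zero_mul]
        refine squeeze_zero_norm (fun y => ?_) hlim
        rw [Real.norm_eq_abs, abs_mul, abs_of_nonneg (hχ y).1]
        exact mul_le_mul_of_nonneg_left (hcl y) (hχ y).1
      · refine χ.continuous.continuousAt.mul ?_
        exact continuousAt_const.max (continuousAt_const.min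
          (hc1i.continuousAt.div hc2i.continuousAt hz))
    let δ : openPiece t s → ℝ := fun z =>
      (z : ℂ × ℂ).2.re * (χ z * cl z) + (1 - χ z) * (K * |(z : ℂ × ℂ).2.re|)
    have hδ : Continuous δ := (hc2r.mul hχcl).add
      ((continuous_const.sub χ.continuous).mul (continuous_const.mul hc2r.abs))
    have hmove : ∀ (z : openPiece t s) (c : ℝ), c ∈ Icc (0 : ℝ) 1 →
        ((z : ℂ × ℂ).1 - (c * δ z : ℝ), (z : ℂ × ℂ).2 - (c * (z : ℂ × ℂ).2.re : ℝ)) ∈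
          openPiece t s := by
      rintro ⟨z, hz⟩ c ⟨hc0, hc1⟩
      set d := δ ⟨z, hz⟩ with hd
      simp only
      by_cases hfree : K * |z.2.im| < |z.1.im|
      · -- the imaginary parts of the forms have the same sign, and they do not change
        apply mem_openPiece_of_im_pos (σ := z.1.im)
        intro i
        have h1 := hsw i z.2.im
        have h2 : (form t s i.succ (z.1 - (c * d : ℝ), z.2 - (c * z.2.re : ℝ))).im =
            z.1.im - s i * z.2.im := by simp
        rw [h2]
        have h3 : z.1.im * (s i * z.2.im) ≤ |z.1.im| * |s i * z.2.im| := by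
          rw [← abs_mul]; exact le_abs_self _
        have h4 : z.1.im * z.1.im = |z.1.im| * |z.1.im| := (abs_mul_abs_self _).symm
        have h5 : 0 ≤ K * |z.2.im| := by positivity
        nlinarith
      rw [not_lt] at hfree
      by_cases hw : z.2.im = 0
      · -- real points stay in their chamber
        rw [hw, abs_zero, mul_zero] at hfree
        have h1 := abs_eq_zero.1 (le_antisymm hfree (abs_nonneg _))
        have hneg := re_neg_of_mem_openPiece hz h1 hw
        have hχz : χ ⟨z, hz⟩ = 0 := hχ0 hw
        have hdz : d = K * |z.2.re| := by simp [hd, δ, hχz]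
        apply mem_openPiece_of_re_neg
        intro k
        cases k using Fin.cases with
        | zero => simp
        | succ i =>
          have h2 := hneg i.succ
          simp at h2 ⊢
          have h3 := (abs_le.1 (hsw i z.2.re)).2
          rw [hdz]
          nlinarith
      have hclz : z.2.re * cl ⟨z, hz⟩ = z.2.re / z.2.im * z.1.im := by
        have h1 : |z.1.im / z.2.im| ≤ K := by
          rw [abs_div, div_le_iff₀ (abs_pos.2 hw)]; exact hfree
        have h2 : cl ⟨z, hz⟩ = z.1.im / z.2.im := by
          simp only [cl]
          rw [min_eq_right (abs_le.1 h1).2, max_eq_right (abs_le.1 h1).1]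
        rw [h2]; ring
      set r := -(c * (z.2.re / z.2.im)) with hr
      set e := z.2.re / z.2.im * z.1.im with he
      have hform : (z.1 - (c * d : ℝ), z.2 - (c * z.2.re : ℝ)) =
          shear r (z.1 - (c * (d - e) : ℝ), z.2) := by
        simp only [shear, Prod.mk.injEq, hr, he]
        constructor
        · simp; ring
        · have : z.2.re / z.2.im * z.2.im = z.2.re := div_mul_cancel₀ _ hw
          have h' : ((z.2.re / z.2.im * z.2.im : ℝ) : ℂ) = z.2.re := by rw [this]
          push_cast at h' ⊢
          linear_combination c * h'
      rw [hform]
      apply shear_mem_openPiece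
      by_cases hex : ∃ k, 0 ≤ (form t s k z).re
      · have hχz : χ ⟨z, hz⟩ = 1 := hχ1 ⟨hfree, by simpa using hex⟩
        have hde : d = e := by simp only [hd, δ, hχz, one_mul, hclz]; ring
        simpa [hde] using hz
      · push Not at hex
        have hed : e ≤ d := by
          have h1 : e ≤ K * |z.2.re| := by
            rw [← hclz, mul_comm K]
            refine (le_abs_self _).trans ?_
            rw [abs_mul]
            exact mul_le_mul_of_nonneg_left (hcl _) (abs_nonneg _)
          have h2 : d = e * χ ⟨z, hz⟩ + (1 - χ ⟨z, hz⟩) * (K * |z.2.re|) := by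
            simp only [hd, δ]; linear_combination χ ⟨z, hz⟩ * hclz
          have h3 := (hχ ⟨z, hz⟩).2
          nlinarith
        apply mem_openPiece_of_re_neg
        intro k
        have h2 := hex k
        cases k using Fin.cases with
        | zero => simp
        | succ i =>
          simp at h2 ⊢
          nlinarith [mul_nonneg hc0 (sub_nonneg.2 hed)]
    have := contractibleSpace_slit (t (Fin.last m))
    have hend : ∀ z : openPiece t s, ((z : ℂ × ℂ).1 - (δ z : ℝ),
        ((z : ℂ × ℂ).2.im * Complex.I : ℂ)) ∈ openPiece t s := by
      intro z
      have := hmove z 1 (by simp)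
      convert this using 2
      · simp
      · apply Complex.ext <;> simp
    refine contractibleSpace_of_segment
      (Y := {q : ℂ × ℝ | ¬ (t (Fin.last m) ≤ q.1.re ∧ q.1.im = 0)})
      (fun z => ⟨((z : ℂ × ℂ).1 - (δ z : ℝ) -
        ((z : ℂ × ℂ).2.im * G ((z : ℂ × ℂ).1 - (δ z : ℝ)).re : ℝ) * Complex.I,
          (z : ℂ × ℂ).2.im), ?_⟩) ?_
      (fun q => ((q : ℂ × ℝ).1 + ((q : ℂ × ℝ).2 * G (q : ℂ × ℝ).1.re : ℝ) * Complex.I,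
        ((q : ℂ × ℝ).2 * Complex.I : ℂ))) ?_ ?_ ?_
    · rintro ⟨h1, h2⟩
      apply (hslice _ _).1 (hend z)
      simp at h1 h2 ⊢
      exact ⟨h1, by linarith⟩
    · refine Continuous.subtype_mk ?_ _
      have hr : Continuous fun z : openPiece t s => (z : ℂ × ℂ).1 - (δ z : ℝ) := by fun_prop
      have hrr := hG.comp (Complex.continuous_re.comp hr)
      simp only [Function.comp_def] at hrr
      fun_prop
    · have : Continuous fun q : {q : ℂ × ℝ | ¬ (t (Fin.last m) ≤ q.1.re ∧ q.1.im = 0)} =>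
          G (q : ℂ × ℝ).1.re := hG.comp (by fun_prop)
      fun_prop
    · intro q
      rw [hslice]
      rintro ⟨h1, h2⟩
      apply q.2
      simp at h1 h2
      exact ⟨h1, h2⟩
    · intro z c hc
      convert hmove z c hc using 1
      ext1
      · simp; ring
      · apply Complex.ext <;> simp <;> ring

end Sweep

/-! ### Sails in terms of values of the forms -/

namespace AffineForm

lemma mem_sail {f g : AffineForm} {z : ℂ × ℂ} :
    z ∈ f.sail g ↔ g.evalC z ≠ 0 ∧ AreOpposite (f.evalC z) (g.evalC z) := by
  constructor
  · rintro ⟨h0, r, hr, h⟩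
    have hg := right_ne_zero_of_mul h0
    refine ⟨hg, -r, neg_pos.2 hr, ?_⟩
    rw [div_eq_iff hg] at h
    push_cast
    linear_combination h
  · rintro ⟨hg, ρ, hρ, h⟩
    have hf : f.evalC z = ((-ρ : ℝ) : ℂ) * g.evalC z := by push_cast; linear_combination h
    refine ⟨?_, -ρ, neg_lt_zero.2 hρ, by rw [div_eq_iff hg, hf]⟩
    rw [hf]
    exact mul_ne_zero (mul_ne_zero (by exact_mod_cast (neg_lt_zero.2 hρ).ne) hg) hg

end AffineForm

/-- Being a negative multiple, in terms of the real and imaginary parts of `a * conj b`. -/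
lemma areOpposite_iff {a b : ℂ} (ha : a ≠ 0) (hb : b ≠ 0) :
    AreOpposite a b ↔ a.im * b.re - a.re * b.im = 0 ∧ a.re * b.re + a.im * b.im ≤ 0 := by
  have hN : 0 < b.re * b.re + b.im * b.im := by
    simpa [Complex.normSq_apply] using Complex.normSq_pos.2 hb
  constructor
  · rintro ⟨ρ, hρ, h⟩
    have h1 := congrArg Complex.re h
    have h2 := congrArg Complex.im h
    simp at h1 h2
    constructor
    · linear_combination b.re * h2 - b.im * h1
    · have : a.re * b.re + a.im * b.im = -ρ * (b.re * b.re + b.im * b.im) := by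
        linear_combination b.re * h1 + b.im * h2
      nlinarith [mul_pos hρ hN]
  · rintro ⟨h1, h2⟩
    have h3 : a.re * b.re + a.im * b.im ≠ 0 := by
      intro h0
      have hM : 0 < a.re * a.re + a.im * a.im := by
        simpa [Complex.normSq_apply] using Complex.normSq_pos.2 ha
      have : (a.re * a.re + a.im * a.im) * (b.re * b.re + b.im * b.im) = 0 := by
        linear_combination (a.im * b.re - a.re * b.im) * h1 + (a.re * b.re + a.im * b.im) * h0
      exact (mul_pos hM hN).ne' this
    have h4 : a.re * b.re + a.im * b.im < 0 := lt_of_le_of_ne h2 h3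
    refine ⟨-(a.re * b.re + a.im * b.im) / (b.re * b.re + b.im * b.im),
      div_pos (neg_pos.2 h4) hN, ?_⟩
    apply Complex.ext
    · simp only [Complex.add_re, Complex.re_ofReal_mul, Complex.zero_re]
      rw [div_mul_eq_mul_div, add_div' _ _ _ hN.ne', div_eq_zero_iff]
      left
      linear_combination -b.im * h1
    · simp only [Complex.add_im, Complex.im_ofReal_mul, Complex.zero_im]
      rw [div_mul_eq_mul_div, add_div' _ _ _ hN.ne', div_eq_zero_iff]
      left
      linear_combination b.re * h1

lemma areOpposite_ofReal {a b : ℝ} (hb : b ≠ 0) : AreOpposite (a : ℂ) b ↔ b * a < 0 := by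
  constructor
  · rintro ⟨ρ, hρ, h⟩
    have h : a + ρ * b = 0 := by exact_mod_cast h
    have := mul_pos hρ (mul_self_pos.2 hb)
    have : b * a = -(ρ * (b * b)) := by linear_combination b * h
    linarith
  · intro h
    refine ⟨-(b * a) / (b * b), div_pos (neg_pos.2 h) (mul_self_pos.2 hb), ?_⟩
    norm_cast
    field_simp
    ring

namespace LineArrangement

variable {n : ℕ} {A : LineArrangement n}

@[simp] lemma alpha_zero (A : LineArrangement n) : A.alpha 0 = ⟨0, 0, -1⟩ := rfl
@[simp] lemma alpha_succ (A : LineArrangement n) (i : Fin n) : A.alpha i.succ = A.form i := rfl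

lemma alpha_evalC_ne_zero {z : ℂ × ℂ} (hz : z ∈ A.complement) (k : Fin (n + 1)) :
    (A.alpha k).evalC z ≠ 0 := by
  cases k using Fin.cases with
  | zero => simp [AffineForm.evalC]
  | succ i => exact hz i

lemma alpha_eval_ne_zero {x : ℝ × ℝ} (hx : x ∈ A.realComplement) (k : Fin (n + 1)) :
    (A.alpha k).eval x ≠ 0 := by
  cases k using Fin.cases with
  | zero => simp [AffineForm.eval]
  | succ i => exact hx i

lemma alpha_eval_mul_pos {x y : ℝ × ℝ} (h : y ∈ A.cell x) (k : Fin (n + 1)) :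
    0 < (A.alpha k).eval x * (A.alpha k).eval y := by
  cases k using Fin.cases with
  | zero => simp [AffineForm.eval]
  | succ i => exact h i

lemma mem_sail {i : Fin n} {z : ℂ × ℂ} : z ∈ A.sail i ↔ z ∈ A.complement ∧
    AreOpposite ((A.alpha i.castSucc).evalC z) ((A.alpha i.succ).evalC z) := by
  rw [sail, mem_inter_iff, AffineForm.mem_sail]
  exact ⟨fun h => ⟨h.2, h.1.2⟩, fun h => ⟨⟨h.1 i, h.2⟩, h.1⟩⟩

lemma realPoint_mem_sail {i : Fin n} {x : ℝ × ℝ} : realPoint x ∈ A.sail i ↔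
    x ∈ A.realComplement ∧ (A.alpha i.succ).eval x * (A.alpha i.castSucc).eval x < 0 := by
  rw [mem_sail, realPoint_mem_complement]
  refine and_congr_right fun hx => ?_
  rw [AffineForm.evalC_realPoint, AffineForm.evalC_realPoint,
    areOpposite_ofReal (alpha_eval_ne_zero hx _)]

lemma signChange_cell {i : Fin n} {x : ℝ × ℝ} (hx : x ∈ A.realComplement) :
    A.SignChange i (A.cell x) ↔
      (A.alpha i.succ).eval x * (A.alpha i.castSucc).eval x < 0 := by
  refine ⟨fun h => h x (self_mem_cell hx), fun h y hy => ?_⟩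
  have h1 := alpha_eval_mul_pos hy i.succ
  have h2 := alpha_eval_mul_pos hy i.castSucc
  by_contra hn
  rw [not_lt] at hn
  have h3 := mul_pos h1 h2
  nlinarith

lemma isOpen_complement (A : LineArrangement n) : IsOpen A.complement := by
  have : A.complement = ⋂ i, {z | (A.form i).evalC z ≠ 0} := by ext; simp [complement]
  rw [this]
  exact isOpen_iInter_of_finite fun i => isOpen_ne_fun (A.form i).continuous_evalC continuous_const

/-- The sails are closed in the complement of the lines. -/
lemma exists_isClosed_sail (A : LineArrangement n) (i : Fin n) :
    ∃ K : Set (ℂ × ℂ), IsClosed K ∧ A.sail i = K ∩ A.complement := by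
  set a := (A.alpha i.castSucc).evalC with ha
  set b := (A.alpha i.succ).evalC with hb
  have hac : Continuous a := AffineForm.continuous_evalC _
  have hbc : Continuous b := AffineForm.continuous_evalC _
  refine ⟨{z | (a z).im * (b z).re - (a z).re * (b z).im = 0 ∧
    (a z).re * (b z).re + (a z).im * (b z).im ≤ 0}, ?_, ?_⟩
  · have h1 : Continuous fun z => (a z).im * (b z).re - (a z).re * (b z).im := by fun_prop
    have h2 : Continuous fun z => (a z).re * (b z).re + (a z).im * (b z).im := by fun_prop
    exact (isClosed_eq h1 continuous_const).inter (isClosed_le h2 continuous_const)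
  · ext z
    rw [mem_sail, mem_inter_iff, and_comm]
    refine and_congr_left fun hz => ?_
    exact areOpposite_iff (alpha_evalC_ne_zero hz _) (alpha_evalC_ne_zero hz _)

lemma isOpen_openPiece (A : LineArrangement n) : IsOpen A.openPiece := by
  choose K hK hKs using A.exists_isClosed_sail
  have : A.openPiece = A.complement ∩ ⋂ i, (K i)ᶜ := by
    ext z
    simp only [openPiece, hKs, mem_sdiff, mem_iUnion, mem_inter_iff, mem_iInter, mem_compl_iff,
      not_exists, not_and]
    exact and_congr_right fun hz => forall_congr' fun i =>
      ⟨fun h h' => h h' hz, fun h h' _ => h h'⟩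
  rw [this]
  exact A.isOpen_complement.inter (isOpen_iInter_of_finite fun i => (hK i).isOpen_compl)

namespace NumberedFlag

variable (F : A.NumberedFlag)

/-! ### Coordinates adapted to the flag -/

/-- The forms increase in the direction of the flag. -/
lemma form_dir_pos (i : Fin n) : 0 < (A.form i).a * F.dir.1 + (A.form i).b * F.dir.2 := by
  have h := (F.eval_eq_zero_iff i (F.pos i)).2 rfl
  rw [AffineForm.eval_add_smul] at h
  have h1 := F.eval_base_neg i
  have h2 := F.pos_pos i
  by_contra hn
  nlinarith

lemma alpha_dir_nonneg (k : Fin (n + 1)) :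
    0 ≤ (A.alpha k).a * F.dir.1 + (A.alpha k).b * F.dir.2 := by
  cases k using Fin.cases with
  | zero => simp
  | succ i => exact (F.form_dir_pos i).le

lemma dir_normSq_pos : 0 < F.dir.1 ^ 2 + F.dir.2 ^ 2 := by
  have h : F.dir.1 ≠ 0 ∨ F.dir.2 ≠ 0 := by
    by_contra! h
    exact F.dir_ne_zero (Prod.ext h.1 h.2)
  rcases h with h | h <;> positivity

/-- Coordinates of `ℂ²` with origin at the base point of the flag, in which `(1, 0)` stands for the
direction of the flag, and `(0, 1)` for a vector orthogonal to it. -/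
def coord : (ℂ × ℂ) ≃ₜ (ℂ × ℂ) where
  toFun z := (F.base.1 + z.1 * F.dir.1 - z.2 * F.dir.2, F.base.2 + z.1 * F.dir.2 + z.2 * F.dir.1)
  invFun w := (((w.1 - F.base.1) * F.dir.1 + (w.2 - F.base.2) * F.dir.2) /
      ((F.dir.1 ^ 2 + F.dir.2 ^ 2 : ℝ) : ℂ),
    ((w.2 - F.base.2) * F.dir.1 - (w.1 - F.base.1) * F.dir.2) /
      ((F.dir.1 ^ 2 + F.dir.2 ^ 2 : ℝ) : ℂ))
  left_inv z := by
    have h : ((F.dir.1 ^ 2 + F.dir.2 ^ 2 : ℝ) : ℂ) ≠ 0 := by exact_mod_cast F.dir_normSq_pos.ne'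
    ext1 <;> simp only <;> rw [div_eq_iff h] <;> push_cast <;> ring
  right_inv w := by
    have h : ((F.dir.1 ^ 2 + F.dir.2 ^ 2 : ℝ) : ℂ) ≠ 0 := by exact_mod_cast F.dir_normSq_pos.ne'
    have h' : (F.dir.1 : ℂ) ^ 2 + (F.dir.2 : ℂ) ^ 2 ≠ 0 := by exact_mod_cast h
    ext1 <;> simp only <;> push_cast <;> field_simp <;> ring
  continuous_toFun := by fun_prop
  continuous_invFun := by
    have h : ((F.dir.1 ^ 2 + F.dir.2 ^ 2 : ℝ) : ℂ) ≠ 0 := by exact_mod_cast F.dir_normSq_pos.ne'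
    refine Continuous.prodMk (Continuous.div_const ?_ _) (Continuous.div_const ?_ _) <;> fun_prop

lemma coord_apply (z : ℂ × ℂ) : F.coord z =
    (F.base.1 + z.1 * F.dir.1 - z.2 * F.dir.2, F.base.2 + z.1 * F.dir.2 + z.2 * F.dir.1) := rfl

/-- The positive factors by which the forms differ from those in `Sweep.form`. -/
def scale (k : Fin (n + 1)) : ℝ :=
  (Fin.cons 1 fun i => (A.form i).a * F.dir.1 + (A.form i).b * F.dir.2 : Fin (n + 1) → ℝ) k

/-- The speed at which the intersection point with a line parallel to the flag moves. -/
def slope (i : Fin n) : ℝ :=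
  ((A.form i).a * F.dir.2 - (A.form i).b * F.dir.1) /
    ((A.form i).a * F.dir.1 + (A.form i).b * F.dir.2)

lemma scale_pos (k : Fin (n + 1)) : 0 < F.scale k := by
  cases k using Fin.cases with
  | zero => simp [scale]
  | succ i => simpa [scale] using F.form_dir_pos i

lemma evalC_coord (k : Fin (n + 1)) (z : ℂ × ℂ) :
    (A.alpha k).evalC (F.coord z) = F.scale k * Sweep.form F.pos F.slope k z := by
  cases k using Fin.cases with
  | zero => simp [scale, AffineForm.evalC]
  | succ i =>
    have hpos := F.form_dir_pos i
    have hs : F.slope i * ((A.form i).a * F.dir.1 + (A.form i).b * F.dir.2) =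
        (A.form i).a * F.dir.2 - (A.form i).b * F.dir.1 := div_mul_cancel₀ _ hpos.ne'
    have hs' : (F.slope i : ℂ) * ((A.form i).a * F.dir.1 + (A.form i).b * F.dir.2) =
        (A.form i).a * F.dir.2 - (A.form i).b * F.dir.1 := by exact_mod_cast hs
    have h := (F.eval_eq_zero_iff i (F.pos i)).2 rfl
    rw [AffineForm.eval_add_smul, AffineForm.eval] at h
    have h' : ((A.form i).a : ℂ) * F.base.1 + (A.form i).b * F.base.2 + (A.form i).c +
        F.pos i * ((A.form i).a * F.dir.1 + (A.form i).b * F.dir.2) = 0 := by exact_mod_cast h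
    simp only [alpha_succ, AffineForm.evalC, coord_apply, scale, Fin.cons_succ, Sweep.form_succ]
    push_cast
    linear_combination h' + z.2 * hs'

lemma coord_mem_range_realPoint {z : ℂ × ℂ} :
    F.coord z ∈ range realPoint ↔ z.1.im = 0 ∧ z.2.im = 0 := by
  rw [mem_range_realPoint, coord_apply]
  simp
  have hpos := F.dir_normSq_pos
  constructor
  · rintro ⟨h1, h2⟩
    have e1 : (F.dir.1 ^ 2 + F.dir.2 ^ 2) * z.1.im = 0 := by
      linear_combination F.dir.1 * h1 + F.dir.2 * h2
    have e2 : (F.dir.1 ^ 2 + F.dir.2 ^ 2) * z.2.im = 0 := by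
      linear_combination F.dir.1 * h2 - F.dir.2 * h1
    exact ⟨(mul_eq_zero.1 e1).resolve_left hpos.ne', (mul_eq_zero.1 e2).resolve_left hpos.ne'⟩
  · rintro ⟨h1, h2⟩
    simp [h1, h2]

lemma eval_line (k : Fin (n + 1)) (r : ℝ) :
    (A.alpha k).eval (F.base + r • F.dir) = F.scale k * Sweep.lineForm F.pos k r := by
  have h := F.evalC_coord k ((r : ℂ), 0)
  have hr : F.coord ((r : ℂ), 0) = realPoint (F.base + r • F.dir) := by
    simp [coord_apply, realPoint]
  rw [hr, AffineForm.evalC_realPoint, Sweep.form_real] at h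
  exact_mod_cast h

lemma mem_space_one {x : ℝ × ℝ} : x ∈ F.space 1 ↔ ∃ r : ℝ, F.base + r • F.dir = x := by
  simp [space]

lemma coord_mem_complement {z : ℂ × ℂ} :
    F.coord z ∈ A.complement ↔ ∀ k, Sweep.form F.pos F.slope k z ≠ 0 := by
  have hs : ∀ k, (F.scale k : ℂ) ≠ 0 := fun k => by exact_mod_cast (F.scale_pos k).ne'
  constructor
  · intro h k h0
    apply alpha_evalC_ne_zero h k
    rw [evalC_coord, h0, mul_zero]
  · intro h i
    have := F.evalC_coord i.succ z
    rw [alpha_succ] at this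
    rw [this]
    exact mul_ne_zero (hs _) (h _)

lemma areOpposite_coord {i : Fin n} {z : ℂ × ℂ} :
    AreOpposite ((A.alpha i.castSucc).evalC (F.coord z)) ((A.alpha i.succ).evalC (F.coord z)) ↔
      AreOpposite (Sweep.form F.pos F.slope i.castSucc z) (Sweep.form F.pos F.slope i.succ z) := by
  rw [evalC_coord, evalC_coord, areOpposite_mul_iff (F.scale_pos _) (F.scale_pos _)]

lemma coord_preimage_openPiece : F.coord ⁻¹' A.openPiece = Sweep.openPiece F.pos F.slope := by
  ext z
  simp only [openPiece, mem_preimage, mem_sdiff, mem_iUnion, mem_sail, not_exists, not_and,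
    Sweep.openPiece, mem_ofPred_eq, coord_mem_complement, areOpposite_coord]
  exact and_congr_right fun h => forall_congr' fun i => ⟨fun h' => h' h, fun h' _ => h'⟩

theorem contractibleSpace_openPiece (F : A.NumberedFlag) : ContractibleSpace A.openPiece := by
  have := Sweep.contractibleSpace_openPiece (s := F.slope) F.pos_strictAnti
  exact (F.coord.sets F.coord_preimage_openPiece.symm).symm.contractibleSpace

/-! ### Real points of the pieces -/

/-- A point where two different consecutive pairs of forms are opposite is real. -/
lemma mem_range_realPoint_of_areOpposite (F : A.NumberedFlag) {i j : Fin n} (hij : i ≠ j)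
    {w : ℂ × ℂ}
    (hi : AreOpposite ((A.alpha i.castSucc).evalC w) ((A.alpha i.succ).evalC w))
    (hj : AreOpposite ((A.alpha j.castSucc).evalC w) ((A.alpha j.succ).evalC w)) :
    w ∈ range realPoint := by
  obtain ⟨z, rfl⟩ := F.coord.surjective w
  rw [areOpposite_coord] at hi hj
  rw [coord_mem_range_realPoint]
  by_cases hz : z.2.im = 0
  · exact ⟨Sweep.im_eq_zero_of_opposite hz hi, hz⟩
  · exact absurd (Sweep.eq_of_opposite F.pos_strictAnti hz hi hj) hij

/-- On the line of the flag, one sign change of consecutive forms determines all signs. -/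
lemma line_signs {i : Fin n} {r : ℝ}
    (h : (A.alpha i.succ).eval (F.base + r • F.dir) *
      (A.alpha i.castSucc).eval (F.base + r • F.dir) < 0) (k : Fin (n + 1)) :
    (k ≤ i.castSucc → (A.alpha k).eval (F.base + r • F.dir) < 0) ∧
      (i.succ ≤ k → 0 < (A.alpha k).eval (F.base + r • F.dir)) := by
  rw [eval_line, eval_line] at h
  have hs := F.scale_pos
  have h' : Sweep.lineForm F.pos i.succ r * Sweep.lineForm F.pos i.castSucc r < 0 := by
    by_contra hn
    have := mul_nonneg (mul_pos (hs i.succ) (hs i.castSucc)).le (not_lt.1 hn)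
    nlinarith
  have hne : Sweep.lineForm F.pos i.succ r ≠ 0 := left_ne_zero_of_mul h'.ne
  obtain ⟨ρ, hρ, hrel⟩ := (areOpposite_ofReal hne).2 h'
  have := Sweep.lineForm_signs F.pos_strictAnti hρ (by exact_mod_cast hrel) k
  rw [eval_line]
  exact ⟨fun hk => mul_neg_of_pos_of_neg (hs k) (this.1 hk), fun hk => mul_pos (hs k) (this.2 hk)⟩

/-- On the line of the flag, at most one pair of consecutive forms has opposite signs. -/
lemma eq_of_signChange_line {i j : Fin n} {r : ℝ}
    (hi : (A.alpha i.succ).eval (F.base + r • F.dir) *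
      (A.alpha i.castSucc).eval (F.base + r • F.dir) < 0)
    (hj : (A.alpha j.succ).eval (F.base + r • F.dir) *
      (A.alpha j.castSucc).eval (F.base + r • F.dir) < 0) : i = j := by
  rcases lt_trichotomy i j with h | h | h
  · have h1 := (F.line_signs hi i.succ).2 le_rfl
    have h2 := (F.line_signs hj i.succ).1 (Fin.castSucc_lt_iff_succ_le.1
      (Fin.castSucc_lt_castSucc_iff.2 h))
    exact absurd h1 h2.not_gt
  · exact h
  · have h1 := (F.line_signs hj j.succ).2 le_rfl
    have h2 := (F.line_signs hi j.succ).1 (Fin.castSucc_lt_iff_succ_le.1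
      (Fin.castSucc_lt_castSucc_iff.2 h))
    exact absurd h1 h2.not_gt

/-- The signs of the forms on the part of the line of the flag between two of its intersection
points with the lines. -/
def signRegion (A : LineArrangement n) (i : Fin n) : Set (ℂ × ℂ) :=
  {w | ∀ k : Fin (n + 1), (k ≤ i.castSucc → ((A.alpha k).evalC w).re < 0) ∧
    (i.succ ≤ k → 0 < ((A.alpha k).evalC w).re)}

lemma isOpen_signRegion (i : Fin n) : IsOpen (signRegion A i) := by
  have : signRegion A i = ⋂ k, ({w | k ≤ i.castSucc → ((A.alpha k).evalC w).re < 0} ∩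
      {w | i.succ ≤ k → 0 < ((A.alpha k).evalC w).re}) := by
    ext; simp [signRegion]
  rw [this]
  refine isOpen_iInter_of_finite fun k => ?_
  have hc : Continuous fun w => ((A.alpha k).evalC w).re :=
    Complex.continuous_re.comp (AffineForm.continuous_evalC _)
  refine IsOpen.inter ?_ ?_
  · by_cases h : k ≤ i.castSucc
    · simpa [h] using isOpen_lt hc continuous_const
    · simp [h]
  · by_cases h : i.succ ≤ k
    · simpa [h] using isOpen_lt continuous_const hc
    · simp [h]

lemma cell_eq_of_signs {x y : ℝ × ℝ} {i : Fin n}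
    (hx : ∀ k : Fin (n + 1), (k ≤ i.castSucc → (A.alpha k).eval x < 0) ∧
      (i.succ ≤ k → 0 < (A.alpha k).eval x))
    (hy : ∀ k : Fin (n + 1), (k ≤ i.castSucc → (A.alpha k).eval y < 0) ∧
      (i.succ ≤ k → 0 < (A.alpha k).eval y)) : y ∈ A.cell x := by
  intro j
  rw [← alpha_succ]
  rcases le_or_gt j.succ i.castSucc with h | h
  · exact mul_pos_of_neg_of_neg ((hx _).1 h) ((hy _).1 h)
  · have h := Fin.castSucc_lt_iff_succ_le.1 h
    exact mul_pos ((hx _).2 h) ((hy _).2 h)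

/-- Of the real points of a sail, its piece keeps exactly those of one chamber. -/
lemma sailPiece_eq (i : Fin n) :
    F.sailPiece i = A.sail i ∩ ((range realPoint)ᶜ ∪ signRegion A i) := by
  ext w
  rw [sailPiece, mem_sdiff, mem_inter_iff]
  refine and_congr_right fun hw => ?_
  simp only [mem_iUnion, exists_prop, not_exists, not_and, mem_union, mem_compl_iff]
  constructor
  · intro h
    rw [or_iff_not_imp_left, not_not]
    rintro ⟨x, rfl⟩
    obtain ⟨hx, hsign⟩ := realPoint_mem_sail.1 hw
    have hch : A.cell x ∉ F.ch 2 := fun hC => h _ hC ⟨x, self_mem_cell hx, rfl⟩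
    rw [F.cell_mem_ch_two hx] at hch
    push Not at hch
    obtain ⟨y, hy, hyx⟩ := hch
    obtain ⟨r, rfl⟩ := F.mem_space_one.1 hy
    have hsy := (signChange_cell hx).2 hsign _ hyx
    intro k
    have h1 := F.line_signs hsy k
    have h2 := alpha_eval_mul_pos hyx k
    rw [AffineForm.evalC_realPoint, Complex.ofReal_re]
    exact ⟨fun hk => neg_of_mul_pos_left h2 (h1.1 hk).le,
      fun hk => pos_of_mul_pos_left h2 (h1.2 hk).le⟩
  · rintro h C hC ⟨x, hx, rfl⟩
    have hs := h.resolve_left (not_not.2 ⟨x, rfl⟩)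
    have hs' : ∀ k : Fin (n + 1), (k ≤ i.castSucc → (A.alpha k).eval x < 0) ∧
        (i.succ ≤ k → 0 < (A.alpha k).eval x) := fun k => by
      simpa only [AffineForm.evalC_realPoint, Complex.ofReal_re] using hs k
    obtain ⟨hC1, hC2⟩ := F.mem_ch_two.1 hC
    have hxc : x ∈ A.realComplement := (realPoint_mem_sail.1 hw).1
    obtain rfl := eq_cell_of_mem hC1 hx
    obtain ⟨X, hX⟩ := Sweep.exists_lineForm_signs F.pos_strictAnti i
    have hy : F.base + X • F.dir ∈ A.cell x := by
      refine cell_eq_of_signs hs' fun k => ?_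
      rw [eval_line]
      exact ⟨fun hk => mul_neg_of_pos_of_neg (F.scale_pos k) ((hX k).1 hk),
        fun hk => mul_pos (F.scale_pos k) ((hX k).2 hk)⟩
    have : F.base + X • F.dir ∈ A.cell x ∩ F.space 1 := ⟨hy, F.mem_space_one.2 ⟨X, rfl⟩⟩
    rw [hC2] at this
    exact this

lemma coord_preimage_sailPiece (i : Fin n) :
    F.coord ⁻¹' F.sailPiece i = Sweep.sailPiece F.pos F.slope i := by
  ext z
  rw [mem_preimage, sailPiece_eq, mem_inter_iff, mem_sail, coord_mem_complement,
    areOpposite_coord, mem_union, mem_compl_iff, coord_mem_range_realPoint]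
  have hsign : F.coord z ∈ signRegion A i ↔ Sweep.Signs F.pos F.slope i z := by
    refine forall_congr' fun k => ?_
    rw [evalC_coord, Complex.re_ofReal_mul, mul_pos_iff_of_pos_left (F.scale_pos k)]
    have : F.scale k * (Sweep.form F.pos F.slope k z).re < 0 ↔
        (Sweep.form F.pos F.slope k z).re < 0 := by
      constructor
      · intro h; by_contra hn
        exact absurd h (not_lt.2 (mul_nonneg (F.scale_pos k).le (not_lt.1 hn)))
      · exact mul_neg_of_pos_of_neg (F.scale_pos k)
    rw [this]
  rw [hsign]
  constructor
  · rintro ⟨⟨-, h1⟩, h2⟩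
    refine ⟨h1, h2.imp_left fun h h0 => h ⟨Sweep.im_eq_zero_of_opposite h0 h1, h0⟩⟩
  · rintro ⟨h1, h2⟩
    refine ⟨⟨?_, h1⟩, h2.imp_left fun h h0 => h h0.2⟩
    intro k h0
    rcases h2 with h2 | h2
    · exact Sweep.form_ne_zero_of_opposite F.pos_strictAnti h2 h1 k h0
    · have := h2 k
      rw [h0, Complex.zero_re] at this
      rcases le_or_gt k i.castSucc with h | h
      · exact lt_irrefl _ (this.1 h)
      · exact lt_irrefl _ (this.2 (Fin.castSucc_lt_iff_succ_le.1 h))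

theorem contractibleSpace_sailPiece (i : Fin n) : ContractibleSpace (F.sailPiece i) := by
  have := Sweep.contractibleSpace_sailPiece (s := F.slope) F.pos_strictAnti i
  exact (F.coord.sets (F.coord_preimage_sailPiece i).symm).symm.contractibleSpace

end NumberedFlag

end LineArrangement

/-! ### Submanifolds and tangent vectors -/

lemma finrank_complex_prod : Module.finrank ℝ (ℂ × ℂ) = 4 := by
  simp [Module.finrank_prod, Complex.finrank_real_complex]

lemma isSmoothSubmanifold_of_isOpen {S : Set (ℂ × ℂ)} (hS : IsOpen S) :
    IsSmoothSubmanifold 4 S := by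
  refine ⟨0, by rw [finrank_complex_prod], fun x hx => ⟨S, hS, hx, fun _ => 0, contDiffOn_const,
    fun y _ => Function.surjective_to_subsingleton _, ?_⟩⟩
  ext y; simp

namespace AffineForm

lemma contDiff_evalC (f : AffineForm) : ContDiff ℝ ∞ f.evalC := by
  unfold evalC; fun_prop

/-- The derivative of a form in the direction `v`. -/
def along (f : AffineForm) (v : ℝ × ℝ) : ℝ := f.a * v.1 + f.b * v.2

lemma evalC_add_smul (f : AffineForm) (z : ℂ × ℂ) (c : ℂ) (v : ℝ × ℝ) :
    f.evalC (z + (c * v.1, c * v.2)) = f.evalC z + c * f.along v := by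
  simp [evalC, along]; ring

end AffineForm

namespace LineArrangement

variable {n : ℕ} {A : LineArrangement n}

namespace NumberedFlag

/-- For `ρ > 0`, the form `αᵢ₋₁ + ρ αᵢ` increases in the direction of the flag. -/
lemma along_dir_pos (F : A.NumberedFlag) (i : Fin n) {ρ : ℝ} (hρ : 0 < ρ) :
    0 < (A.alpha i.castSucc).along F.dir + ρ * (A.alpha i.succ).along F.dir := by
  have h1 : 0 ≤ (A.alpha i.castSucc).along F.dir := F.alpha_dir_nonneg i.castSucc
  have h2 : 0 < (A.alpha i.succ).along F.dir := F.form_dir_pos i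
  have := mul_pos hρ h2
  linarith

/-- The imaginary part of `αᵢ₋₁ * conj αᵢ` is a submersion along the sail: its derivative is
positive in the direction of the flag, multiplied by `√-1 αᵢ`. -/
lemma isSmoothSubmanifold_sail_inter (F : A.NumberedFlag) (i : Fin n) {O : Set (ℂ × ℂ)}
    (hO : IsOpen O) : IsSmoothSubmanifold 3 (A.sail i ∩ O) := by
  set a := (A.alpha i.castSucc).evalC with ha
  set b := (A.alpha i.succ).evalC with hb
  have hac : ContDiff ℝ ∞ a := AffineForm.contDiff_evalC _
  have hbc : ContDiff ℝ ∞ b := AffineForm.contDiff_evalC _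
  have hre : ∀ {g : ℂ × ℂ → ℂ}, ContDiff ℝ ∞ g → ContDiff ℝ ∞ fun z => (g z).re := fun hg =>
    Complex.reCLM.contDiff.comp hg
  have him : ∀ {g : ℂ × ℂ → ℂ}, ContDiff ℝ ∞ g → ContDiff ℝ ∞ fun z => (g z).im := fun hg =>
    Complex.imCLM.contDiff.comp hg
  set W : Set (ℂ × ℂ) := (A.complement ∩ O) ∩ {z | (a z).re * (b z).re + (a z).im * (b z).im < 0}
    with hW
  have hWo : IsOpen W := (A.isOpen_complement.inter hO).inter
    (isOpen_lt (((hre hac).mul (hre hbc)).add ((him hac).mul (him hbc))).continuous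
      continuous_const)
  set f : ℂ × ℂ → Fin 1 → ℝ := fun z _ => (a z).im * (b z).re - (a z).re * (b z).im with hf
  have hfc : ContDiff ℝ ∞ f := contDiff_pi.2 fun _ =>
    ((him hac).mul (hre hbc)).sub ((hre hac).mul (him hbc))
  have hne : ∀ z ∈ A.complement, a z ≠ 0 ∧ b z ≠ 0 := fun z hz =>
    ⟨alpha_evalC_ne_zero hz _, alpha_evalC_ne_zero hz _⟩
  have hdot : ∀ z ∈ A.sail i, (a z).re * (b z).re + (a z).im * (b z).im < 0 := by
    intro z hz
    obtain ⟨hz, ρ, hρ, h⟩ := mem_sail.1 hz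
    have hN : 0 < (b z).re * (b z).re + (b z).im * (b z).im := by
      simpa [Complex.normSq_apply] using Complex.normSq_pos.2 (hne z hz).2
    have h1 := congrArg Complex.re h
    have h2 := congrArg Complex.im h
    rw [Complex.add_re, Complex.re_ofReal_mul, Complex.zero_re] at h1
    rw [Complex.add_im, Complex.im_ofReal_mul, Complex.zero_im] at h2
    have : (a z).re * (b z).re + (a z).im * (b z).im =
        -(ρ * ((b z).re * (b z).re + (b z).im * (b z).im)) := by
      linear_combination (b z).re * h1 + (b z).im * h2
    linarith [mul_pos hρ hN]
  refine ⟨1, by rw [finrank_complex_prod], fun x hx => ⟨W, hWo,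
    ⟨⟨(mem_sail.1 hx.1).1, hx.2⟩, hdot x hx.1⟩, f, hfc.contDiffOn, ?_, ?_⟩⟩
  · rintro y ⟨⟨hy, -⟩, -⟩
    obtain ⟨hyc, ρ, hρ, hrel⟩ := mem_sail.1 hy
    have hb0 := (hne y hyc).2
    have hN : 0 < (b y).re * (b y).re + (b y).im * (b y).im := by
      simpa [Complex.normSq_apply] using Complex.normSq_pos.2 hb0
    set κ := (A.alpha i.castSucc).along F.dir + ρ * (A.alpha i.succ).along F.dir with hκ
    have hκ0 : 0 < κ := F.along_dir_pos i hρ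
    set d : ℂ × ℂ := (Complex.I * b y * F.dir.1, Complex.I * b y * F.dir.2) with hd
    have hrel' : a y = -ρ * b y := by linear_combination hrel
    have hline : ∀ τ : ℝ, f (y + τ • d) =
        fun _ => τ * (κ * ((b y).re * (b y).re + (b y).im * (b y).im)) := by
      intro τ
      have hτ : y + τ • d = y + ((τ * (Complex.I * b y)) * F.dir.1,
          (τ * (Complex.I * b y)) * F.dir.2) := by
        simp [hd, mul_assoc]
      have h1 : a (y + τ • d) = -ρ * b y +
          (τ * (Complex.I * b y)) * (A.alpha i.castSucc).along F.dir := by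
        rw [hτ, ← hrel']; exact AffineForm.evalC_add_smul _ _ _ _
      have h2 : b (y + τ • d) = b y + (τ * (Complex.I * b y)) * (A.alpha i.succ).along F.dir := by
        rw [hτ]; exact AffineForm.evalC_add_smul _ _ _ _
      funext _
      simp only [hf, h1, h2, hκ]
      simp
      ring
    have hder : HasDerivAt (fun τ : ℝ => f (y + τ • d))
        (fun _ => κ * ((b y).re * (b y).re + (b y).im * (b y).im)) 0 := by
      simp only [hline]
      rw [hasDerivAt_pi]
      intro _
      simpa using (hasDerivAt_id (0 : ℝ)).mul_const
        (κ * ((b y).re * (b y).re + (b y).im * (b y).im))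
    have hfd : DifferentiableAt ℝ f y := hfc.contDiffAt.differentiableAt (by simp)
    have hval : fderiv ℝ f y d =
        fun _ => κ * ((b y).re * (b y).re + (b y).im * (b y).im) :=
      (hfd.hasFDerivAt.hasLineDerivAt d).unique hder
    intro v
    refine ⟨(v 0 / (κ * ((b y).re * (b y).re + (b y).im * (b y).im))) • d, ?_⟩
    rw [map_smul, hval]
    funext j
    rw [Subsingleton.elim j 0, Pi.smul_apply, smul_eq_mul, div_mul_cancel₀ _ (mul_pos hκ0 hN).ne']
  · ext z
    constructor
    · rintro ⟨⟨hz, -⟩, hzW⟩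
      obtain ⟨hzc, hopp⟩ := mem_sail.1 hz
      exact ⟨hzW, funext fun _ => ((areOpposite_iff (hne z hzc).1 (hne z hzc).2).1 hopp).1⟩
    · rintro ⟨hzW, hz⟩
      refine ⟨⟨mem_sail.2 ⟨hzW.1.1, ?_⟩, hzW.1.2⟩, hzW⟩
      exact (areOpposite_iff (hne z hzW.1.1).1 (hne z hzW.1.1).2).2
        ⟨congrFun hz 0, (show _ < _ from hzW.2).le⟩

lemma isSmoothSubmanifold_sail (F : A.NumberedFlag) (i : Fin n) :
    IsSmoothSubmanifold 3 (A.sail i) := by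
  simpa using F.isSmoothSubmanifold_sail_inter i isOpen_univ

lemma isSmoothSubmanifold_sailPiece (F : A.NumberedFlag) (i : Fin n) :
    IsSmoothSubmanifold 3 (F.sailPiece i) := by
  rw [sailPiece_eq]
  refine F.isSmoothSubmanifold_sail_inter i (IsOpen.union ?_ (isOpen_signRegion i))
  have : range realPoint = {z | z.1.im = 0} ∩ {z | z.2.im = 0} := by
    ext z; exact mem_range_realPoint
  rw [this]
  exact ((isClosed_eq (by fun_prop) continuous_const).inter
    (isClosed_eq (by fun_prop) continuous_const)).isOpen_compl

end NumberedFlag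

/-- A vector along which `αᵢ₋₁ + ρ αᵢ` is constant spans a complex line of tangent vectors of the
sail: the straight line stays in the sail for a short time. -/
lemma mem_tangentVectors_sail {i : Fin n} {x : ℂ × ℂ} (hx : x ∈ A.complement) {ρ : ℝ}
    (hρ : 0 < ρ) (hrel : (A.alpha i.castSucc).evalC x + ρ * (A.alpha i.succ).evalC x = 0)
    {η : ℝ × ℝ} (hη : (A.alpha i.castSucc).along η + ρ * (A.alpha i.succ).along η = 0) (c : ℂ) :
    (c * η.1, c * η.2) ∈ tangentVectors (A.sail i) x := by
  set u : ℂ × ℂ := (c * η.1, c * η.2) with hu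
  have hcont : Continuous fun τ : ℝ => x + τ • u := by fun_prop
  have hev : ∀ᶠ τ in 𝓝 (0 : ℝ), x + τ • u ∈ A.complement :=
    hcont.continuousAt.eventually (A.isOpen_complement.mem_nhds (by simpa using hx))
  obtain ⟨ε, hε, h⟩ := Metric.eventually_nhds_iff_ball.1 hev
  rw [Real.ball_eq_Ioo, zero_sub, zero_add] at h
  refine ⟨ε, hε, fun τ => x + τ • u, ?_, ?_, by simp, ?_⟩
  · exact (contDiff_const.add (contDiff_id.smul contDiff_const)).contDiffOn
  · intro τ hτ
    refine mem_sail.2 ⟨h τ hτ, ρ, hρ, ?_⟩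
    have hτu : x + τ • u = x + ((τ * c) * η.1, (τ * c) * η.2) := by simp [hu, mul_assoc]
    have hη' : ((A.alpha i.castSucc).along η : ℂ) + ρ * (A.alpha i.succ).along η = 0 := by
      exact_mod_cast hη
    simp only [hτu, AffineForm.evalC_add_smul]
    linear_combination hrel + τ * c * hη'
  · simpa using ((hasDerivAt_id (0 : ℝ)).smul_const u).const_add x

namespace NumberedFlag

/-- The real lines along which two different sails contain the complexification are not parallel:
otherwise the sails would meet in nonreal points. -/
lemma meetTransversely_sail (F : A.NumberedFlag) {i j : Fin n} (hij : i ≠ j) :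
    MeetTransversely (A.sail i) (A.sail j) := by
  rintro x ⟨hxi, hxj⟩ w
  obtain ⟨hx, hi⟩ := mem_sail.1 hxi
  obtain ⟨-, hj⟩ := mem_sail.1 hxj
  obtain ⟨p, rfl⟩ := F.mem_range_realPoint_of_areOpposite hij hi hj
  obtain ⟨ρ, hρ, hi⟩ := hi
  obtain ⟨σ, hσ, hj⟩ := hj
  -- a vector annihilated by the linear part of `f + r g`
  let ker : AffineForm → AffineForm → ℝ → ℝ × ℝ := fun f g r => (-(f.b + r * g.b), f.a + r * g.a)
  have hker : ∀ f g r, AffineForm.along f (ker f g r) + r * AffineForm.along g (ker f g r) = 0 := by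
    intro f g r
    simp only [AffineForm.along, ker]
    ring
  set η := ker (A.alpha i.castSucc) (A.alpha i.succ) ρ with hη
  set θ := ker (A.alpha j.castSucc) (A.alpha j.succ) σ with hθ
  have hηi := hker (A.alpha i.castSucc) (A.alpha i.succ) ρ
  have hθj := hker (A.alpha j.castSucc) (A.alpha j.succ) σ
  rw [← hη] at hηi
  rw [← hθ] at hθj
  have hdet : η.1 * θ.2 - η.2 * θ.1 ≠ 0 := by
    intro hdet
    have hθi : (A.alpha i.castSucc).along θ + ρ * (A.alpha i.succ).along θ = 0 := by
      have : (A.alpha i.castSucc).along θ + ρ * (A.alpha i.succ).along θ =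
          -(η.1 * θ.2 - η.2 * θ.1) := by
        simp only [AffineForm.along, hη, ker]
        ring
      rw [this, hdet, neg_zero]
    have hreal : realPoint p + (Complex.I * θ.1, Complex.I * θ.2) ∈ range realPoint := by
      refine F.mem_range_realPoint_of_areOpposite hij ⟨ρ, hρ, ?_⟩ ⟨σ, hσ, ?_⟩
      · have h : ((A.alpha i.castSucc).along θ : ℂ) + ρ * (A.alpha i.succ).along θ = 0 := by
          exact_mod_cast hθi
        rw [AffineForm.evalC_add_smul, AffineForm.evalC_add_smul]
        linear_combination hi + Complex.I * h
      · have h : ((A.alpha j.castSucc).along θ : ℂ) + σ * (A.alpha j.succ).along θ = 0 := by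
          exact_mod_cast hθj
        rw [AffineForm.evalC_add_smul, AffineForm.evalC_add_smul]
        linear_combination hj + Complex.I * h
    rw [mem_range_realPoint] at hreal
    simp [realPoint] at hreal
    have hpos := F.along_dir_pos j hσ
    have h1 : (A.alpha j.castSucc).along F.dir + σ * (A.alpha j.succ).along F.dir =
        θ.2 * F.dir.1 - θ.1 * F.dir.2 := by
      simp only [AffineForm.along, hθ, ker]
      ring
    rw [h1, hreal.1, hreal.2] at hpos
    simp at hpos
  have hD : (η.1 * θ.2 - η.2 * θ.1 : ℂ) ≠ 0 := by exact_mod_cast hdet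
  refine ⟨_, mem_tangentVectors_sail hx hρ hi hηi
      ((w.1 * θ.2 - w.2 * θ.1) / (η.1 * θ.2 - η.2 * θ.1)), _,
    mem_tangentVectors_sail hx hσ hj hθj ((η.1 * w.2 - η.2 * w.1) / (η.1 * θ.2 - η.2 * θ.1)), ?_⟩
  ext1 <;> simp only [Prod.fst_add, Prod.snd_add] <;>
    rw [div_mul_eq_mul_div, div_mul_eq_mul_div, ← add_div, div_eq_iff hD] <;> ring

/-! ### Intersections of sails, and the partition -/

lemma sail_inter_sail (F : A.NumberedFlag) {i j : Fin n} (hij : i ≠ j) :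
    A.sail i ∩ A.sail j =
      ⋃ C ∈ {C | C ∈ A.chambers ∧ A.SignChange i C ∧ A.SignChange j C}, realPoint '' C := by
  ext w
  simp only [mem_iUnion, exists_prop]
  constructor
  · rintro ⟨hi, hj⟩
    obtain ⟨x, rfl⟩ := F.mem_range_realPoint_of_areOpposite hij (mem_sail.1 hi).2 (mem_sail.1 hj).2
    obtain ⟨hx, hi⟩ := realPoint_mem_sail.1 hi
    obtain ⟨-, hj⟩ := realPoint_mem_sail.1 hj
    exact ⟨A.cell x, ⟨cell_mem_chambers hx, (signChange_cell hx).2 hi, (signChange_cell hx).2 hj⟩,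
      x, self_mem_cell hx, rfl⟩
  · rintro ⟨C, ⟨hC, hi, hj⟩, x, hxC, rfl⟩
    have hx : x ∈ A.realComplement := by
      obtain ⟨y, -, rfl⟩ := mem_chambers.1 hC
      exact cell_subset hxC
    exact ⟨realPoint_mem_sail.2 ⟨hx, hi x hxC⟩, realPoint_mem_sail.2 ⟨hx, hj x hxC⟩⟩

/-- The chambers in two different sails do not meet the line of the flag. -/
lemma mem_ch_two_of_signChange (F : A.NumberedFlag) {i j : Fin n} (hij : i ≠ j)
    {C : Set (ℝ × ℝ)} (hC : C ∈ A.chambers) (hi : A.SignChange i C) (hj : A.SignChange j C) :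
    C ∈ F.ch 2 := by
  rw [mem_ch_two, Set.eq_empty_iff_forall_notMem]
  refine ⟨hC, ?_⟩
  rintro y ⟨hy, hy'⟩
  obtain ⟨r, rfl⟩ := F.mem_space_one.1 hy'
  exact hij (F.eq_of_signChange_line (hi _ hy) (hj _ hy))

/-- The chamber outside all sails contains the base point of the flag. -/
lemma image_ch_two_subset (F : A.NumberedFlag) {C : Set (ℝ × ℝ)} (hC : C ∈ F.ch 2) :
    realPoint '' C ⊆ A.complement \ A.openPiece := by
  rintro _ ⟨x, hx, rfl⟩
  obtain ⟨hC1, hC2⟩ := F.mem_ch_two.1 hC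
  obtain rfl := eq_cell_of_mem hC1 hx
  refine ⟨realPoint_mem_complement.2 (cell_subset hx), fun hopen => ?_⟩
  obtain ⟨z, hz⟩ := F.coord.surjective (realPoint x)
  have hzo : z ∈ Sweep.openPiece F.pos F.slope := by
    rw [← F.coord_preimage_openPiece, mem_preimage, hz]
    exact hopen
  obtain ⟨h1, h2⟩ := F.coord_mem_range_realPoint.1 ⟨x, hz.symm⟩
  have hbase : F.base ∈ A.cell x := by
    intro i
    have h3 := Sweep.re_neg_of_mem_openPiece hzo h1 h2 i.succ
    have h4 := congrArg Complex.re (F.evalC_coord i.succ z)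
    rw [hz, AffineForm.evalC_realPoint, Complex.ofReal_re, Complex.re_ofReal_mul, alpha_succ] at h4
    refine mul_pos_of_neg_of_neg ?_ (F.eval_base_neg i)
    rw [h4]
    exact mul_neg_of_pos_of_neg (F.scale_pos _) h3
  have : F.base ∈ A.cell x ∩ F.space 1 := ⟨hbase, F.mem_space_one.2 ⟨0, by simp⟩⟩
  rw [hC2] at this
  exact this

lemma iUnion_piece (F : A.NumberedFlag) : ⋃ k, F.piece k = A.complement := by
  ext w
  rw [mem_iUnion]
  constructor
  · rintro ⟨k | k | ⟨C, hC⟩, hk⟩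
    · exact hk.1
    · exact (mem_sail.1 hk.1).1
    · exact (F.image_ch_two_subset hC hk).1
  · intro hw
    by_cases hch : ∃ C ∈ F.ch 2, w ∈ realPoint '' C
    · obtain ⟨C, hC, h⟩ := hch
      exact ⟨Sum.inr (Sum.inr ⟨C, hC⟩), h⟩
    by_cases hs : ∃ i, w ∈ A.sail i
    · obtain ⟨i, hi⟩ := hs
      refine ⟨Sum.inr (Sum.inl i), hi, ?_⟩
      simpa using hch
    · refine ⟨Sum.inl (), hw, ?_⟩
      simpa using hs

lemma pairwise_disjoint_piece (F : A.NumberedFlag) :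
    Pairwise (Function.onFun Disjoint F.piece) := by
  have hUS : ∀ i, Disjoint A.openPiece (F.sailPiece i) := fun i =>
    Set.disjoint_left.2 fun w hw hw' => hw.2 (mem_iUnion.2 ⟨i, hw'.1⟩)
  have hUC : ∀ C : F.ch 2, Disjoint A.openPiece (realPoint '' (C : Set (ℝ × ℝ))) := fun C =>
    Set.disjoint_left.2 fun w hw hw' => (F.image_ch_two_subset C.2 hw').2 hw
  have hSC : ∀ i, ∀ C : F.ch 2, Disjoint (F.sailPiece i) (realPoint '' (C : Set (ℝ × ℝ))) :=
    fun i C => Set.disjoint_left.2 fun w hw hw' => hw.2 (mem_iUnion₂.2 ⟨C, C.2, hw'⟩)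
  have hSS : ∀ i j, i ≠ j → Disjoint (F.sailPiece i) (F.sailPiece j) := by
    intro i j hij
    rw [Set.disjoint_left]
    rintro w ⟨hi, hn⟩ ⟨hj, -⟩
    have hw : w ∈ A.sail i ∩ A.sail j := ⟨hi, hj⟩
    rw [F.sail_inter_sail hij] at hw
    obtain ⟨C, ⟨hC, hCi, hCj⟩, hwC⟩ := mem_iUnion₂.1 hw
    exact hn (mem_iUnion₂.2 ⟨C, F.mem_ch_two_of_signChange hij hC hCi hCj, hwC⟩)
  have hCC : ∀ C D : F.ch 2, C ≠ D →
      Disjoint (realPoint '' (C : Set (ℝ × ℝ))) (realPoint '' (D : Set (ℝ × ℝ))) := fun C D h =>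
    (Set.disjoint_image_iff realPoint_injective).2 (disjoint_chambers
      (F.mem_ch_two.1 C.2).1 (F.mem_ch_two.1 D.2).1 fun h' => h (Subtype.ext h'))
  rintro (⟨⟩ | i | C) (⟨⟩ | j | D) h
  · exact absurd rfl h
  · exact hUS j
  · exact hUC D
  · exact (hUS i).symm
  · exact hSS i j fun h' => h (by rw [h'])
  · exact hSC i D
  · exact (hUC C).symm
  · exact (hSC j C).symm
  · exact hCC C D fun h' => h (by rw [h'])

end NumberedFlag

lemma isSmoothSubmanifold_chamber {C : Set (ℝ × ℝ)} (hC : C ∈ A.chambers) :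
    IsSmoothSubmanifold 2 (realPoint '' C) := by
  have hCo : IsOpen C := by
    obtain ⟨x, -, rfl⟩ := mem_chambers.1 hC
    exact A.isOpen_cell x
  let L : ℂ × ℂ →L[ℝ] (Fin 2 → ℝ) := ContinuousLinearMap.pi
    ![Complex.imCLM.comp (ContinuousLinearMap.fst ℝ ℂ ℂ),
      Complex.imCLM.comp (ContinuousLinearMap.snd ℝ ℂ ℂ)]
  have hre : Continuous fun z : ℂ × ℂ => (z.1.re, z.2.re) := by fun_prop
  refine ⟨2, by rw [finrank_complex_prod], ?_⟩
  rintro _ ⟨x, hx, rfl⟩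
  refine ⟨(fun z : ℂ × ℂ => (z.1.re, z.2.re)) ⁻¹' C, hCo.preimage hre,
    by simpa [realPoint] using hx, L, L.contDiff.contDiffOn, ?_, ?_⟩
  · intro y _ v
    refine ⟨((v 0 : ℂ) * Complex.I, (v 1 : ℂ) * Complex.I), ?_⟩
    rw [L.fderiv]
    funext k
    fin_cases k <;> simp [L]
  · ext z
    constructor
    · rintro ⟨⟨y, hy, rfl⟩, hz⟩
      refine ⟨hz, ?_⟩
      funext k
      fin_cases k <;> simp [L, realPoint]
    · rintro ⟨hz, h⟩
      have h1 : z.1.im = 0 := by simpa [L] using congrFun h 0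
      have h2 : z.2.im = 0 := by simpa [L] using congrFun h 1
      exact ⟨⟨_, hz, realPoint_re h1 h2⟩, hz⟩

lemma contractibleSpace_chamber {C : Set (ℝ × ℝ)} (hC : C ∈ A.chambers) :
    ContractibleSpace (realPoint '' C) := by
  obtain ⟨x, hx, rfl⟩ := mem_chambers.1 hC
  have := (A.convex_cell x).contractibleSpace ⟨x, self_mem_cell hx⟩
  have hre : Continuous fun z : ℂ × ℂ => (z.1.re, z.2.re) := by fun_prop
  have hmem : ∀ z ∈ realPoint '' A.cell x,
      (z.1.re, z.2.re) ∈ A.cell x ∧ realPoint (z.1.re, z.2.re) = z := by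
    rintro _ ⟨y, hy, rfl⟩
    simpa [realPoint] using hy
  refine contractibleSpace_of_segment (Y := A.cell x)
    (fun z => ⟨((z : ℂ × ℂ).1.re, (z : ℂ × ℂ).2.re), (hmem z z.2).1⟩)
    ((hre.comp continuous_subtype_val).subtype_mk _) (fun y => realPoint y)
    (continuous_realPoint.comp continuous_subtype_val) (fun y => ⟨y, y.2, rfl⟩) ?_
  intro z c _
  simp only [(hmem z z.2).2, ← add_smul, sub_add_cancel, one_smul]
  exact z.2

end LineArrangement

end

theorem theorem4p2 (n : ℕ) (A : LineArrangement n) (F : A.NumberedFlag) :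
    -- the `Sᵢ` are closed submanifolds of `M(A)`
    (∀ i : Fin n, IsSmoothSubmanifold 3 (A.sail i) ∧
      ∃ K : Set (ℂ × ℂ), IsClosed K ∧ A.sail i = K ∩ A.complement) ∧
    -- (i)
    (∀ i j : Fin n, i ≠ j →
      MeetTransversely (A.sail i) (A.sail j) ∧
      (A.sail i ∩ A.sail j =
        ⋃ C ∈ {C | C ∈ A.chambers ∧ A.SignChange i C ∧ A.SignChange j C}, realPoint '' C) ∧
      {C | C ∈ A.chambers ∧ A.SignChange i C ∧ A.SignChange j C}.PairwiseDisjoint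
        (fun C => realPoint '' C)) ∧
    -- (ii)
    (∀ i : Fin n, IsSmoothSubmanifold 3 (F.sailPiece i) ∧ ContractibleSpace (F.sailPiece i)) ∧
    -- (iii)
    (IsSmoothSubmanifold 4 A.openPiece ∧ ContractibleSpace A.openPiece) ∧
    -- the partition into contractible pieces, and the number of pieces
    (∀ C ∈ F.ch 2, IsSmoothSubmanifold 2 (realPoint '' C) ∧
      ContractibleSpace (realPoint '' C)) ∧
    ((⋃ k, F.piece k) = A.complement ∧ Pairwise (Function.onFun Disjoint F.piece)) ∧
    (A.intersections.Finite ∧ (F.ch 2).Finite ∧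
      (F.ch 2).ncard = ∑ᶠ p ∈ A.intersections, (A.mult p - 1)) := by
  refine ⟨fun i => ⟨F.isSmoothSubmanifold_sail i, A.exists_isClosed_sail i⟩,
    fun i j hij => ⟨F.meetTransversely_sail hij, F.sail_inter_sail hij, ?_⟩,
    fun i => ⟨F.isSmoothSubmanifold_sailPiece i, F.contractibleSpace_sailPiece i⟩,
    ⟨isSmoothSubmanifold_of_isOpen A.isOpen_openPiece, F.contractibleSpace_openPiece⟩,
    fun C hC => ?_, ⟨F.iUnion_piece, F.pairwise_disjoint_piece⟩, A.finite_intersections,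
    F.ncard_ch_two⟩
  · intro C hC D hD hCD
    exact (Set.disjoint_image_iff realPoint_injective).2
      (LineArrangement.disjoint_chambers hC.1 hD.1 hCD)
  · have hC' := (F.mem_ch_two.1 hC).1
    exact ⟨LineArrangement.isSmoothSubmanifold_chamber hC',
      LineArrangement.contractibleSpace_chamber hC'⟩
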